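/- **Conventions.** $\mathcal S$ is the category with objects the sets $\underline n=\{1,\dots,n\}$ $(n\in\mathbb N)$ and arbitrary functions as maps. For $\varphi:\underline m\to\underline n$ and $i\in\underline n$, $\varepsilon_{\varphi,i}:\varphi^{-1}(i)\to\underline m$ is the unique monotone injection from an object $\varphi^{-1}(i)$ of $\mathcal S$ with image $\{j:\varphi(j)=i\}$, and for $\psi:\underline\ell\to\underline m$, $\psi^\varphi_i:(\varphi\psi)^{-1}(i)\to\varphi^{-1}(i)$ is the map with $\varepsilon_{\varphi,i}\,\psi^\varphi_i=\psi\,\varepsilon_{\varphi\psi,i}$. A small category $\mathcal C$ is *endowed with local terminal objects* if each connected component has a chosen terminal object; $\tau_X:X\to uX$ is the unique map to the chosen terminal object in the component of $X$. $\mathbf{Cat}/\!/\mathcal S$ has as objects small categories $\mathcal C$ with a functor $|{-}|:\mathcal C\to\mathcal S$, and as maps $\mathcal C\to\mathcal C'$ pairs $(F,\nu)$ of a functor $F:\mathcal C\to\mathcal C'$ and a natural transformation $\nu:|{-}|_{\mathcal C}\Rightarrow|F{-}|_{\mathcal C'}$. $\mathbf{Cat}_{\ell t}/\!/\mathcal S$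 is the analogous category in which $\mathcal C$ is endowed with local terminal objects, $|X|=\underline 1$ for each chosen terminal $X$, and $F$ preserves chosen terminals. A map $(F,\nu)$ is *strict* if $\nu$ is an identity (in particular $|{-}|_{\mathcal C}=|F{-}|_{\mathcal C'}$). The forgetful functor $\mathbf{Cat}_{\ell t}/\!/\mathcal S\to\mathbf{Cat}/\!/\mathcal S$ has a right adjoint sending $\mathcal C$ to $D_m(\mathcal C)=\sum_{X\in\mathcal C,\,i\in|X|}\mathcal C/X$, with chosen terminals the objects $(X,i,1_X)$ and with $|(X,i,f)|=|f|^{-1}(i)$, and on maps $g:(X,i,fg)\to(X,i,f)$, $|g|^{|f|}_i$; the counit consists of the slice projections $(X,i,f:Y\to X)\mapsto Y$ together with the maps $\varepsilon_{|f|,i}:|f|^{-1}(i)\to|Y|$. The *modified décalage monad* $\mathsf{\tilde D}_m$ on $\mathbf{Cat}_{\ell t}/\!/\mathcal S$ is the monad induced by this adjunction. A *lax-operadic category* is an object $(\mathcal C,|{-}|)$ of $\mathbf{Cat}_{\ell t}/\!/\mathcal S$ with functors $\varphi_{X,i}:\mathcal C/X\to\mathcal C$ for $X\in\mathcal C$,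 $i\in|X|$, written $f\mapsto f^{-1}(i)$ and $(g:fg\to f)\mapsto g^f_i$, and functions $\gamma_{f,i}:|f|^{-1}(i)\to|f^{-1}(i)|$, such that: - $(1_X)^{-1}(i)$ is a chosen terminal; - $|g^f_i|\circ\gamma_{fg,i}=\gamma_{f,i}\circ|g|^{|f|}_i$; - $\tau_X^{-1}(*)=X$, $f^{\tau_X}_*=f$ for $f:Y\to X$, and $\gamma_{\tau_X,*}=1_{|X|}$; - for $j\in|f|^{-1}(i)$, writing $\gamma j=\gamma_{f,i}(j)$ and $\varepsilon j=\varepsilon_{|f|,i}(j)$: $(g^f_i)^{-1}(\gamma j)=g^{-1}(\varepsilon j)$, $(h^{fg}_i)^{g^f_i}_{\gamma j}=h^g_{\varepsilon j}$, and $\gamma_{g^f_i,\gamma j}\circ\bar\gamma_{fg,i}=\gamma_{g,\varepsilon j}$, where $\bar\gamma_{fg,i}:(|g|^{|f|}_i)^{-1}(j)\to|g^f_i|^{-1}(\gamma j)$ is the restriction of $\gamma_{fg,i}$ to fibres and $(|g|^{|f|}_i)^{-1}(j)=|g|^{-1}(\varepsilon j)$. A *lax-operadic functor* is a map $(F,\nu)$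 of $\mathbf{Cat}_{\ell t}/\!/\mathcal S$ with $F(f^{-1}(i))=(Ff)^{-1}(\nu_X i)$, $F(g^f_i)=(Fg)^{Ff}_{\nu_X i}$ and $\nu_{f^{-1}(i)}\circ\gamma_{f,i}=\gamma_{Ff,\nu_X i}\circ\bar\nu$ for $f:Y\to X$, where $\bar\nu:|f|^{-1}(i)\to|Ff|^{-1}(\nu_X i)$ is the restriction of $\nu_Y$. An *operadic category* is given by $(\mathcal C,|{-}|)$ and functors $\varphi_{X,i}$ as above such that $(1_X)^{-1}(i)$ is a chosen terminal; $|f^{-1}(i)|=|f|^{-1}(i)$ and $|g^f_i|=|g|^{|f|}_i$; $\tau_X^{-1}(*)=X$ and $f^{\tau_X}_*=f$; and $(g^f_i)^{-1}(j)=g^{-1}(\varepsilon j)$ and $(h^{fg}_i)^{g^f_i}_j=h^g_{\varepsilon j}$ for $j\in|f|^{-1}(i)$. An *operadic functor* is a functor $F$ which preserves chosen terminals, satisfies $|F{-}|=|{-}|$, and satisfies $F(f^{-1}(i))=(Ff)^{-1}(i)$ and $F(g^f_i)=(Fg)^{Ff}_i$. Operadic categories and functors are regarded as lax-operadic ones with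 all $\gamma_{f,i}$, respectively all $\nu_X$, identities. The category of $\mathsf{\tilde D}_m$-algebras is isomorphic to the category of lax-operadic categories, by the isomorphism which is the identity on the underlying objects and maps of $\mathbf{Cat}_{\ell t}/\!/\mathcal S$, and which takes a structure map $(\varphi,\gamma):D_m(\mathcal C)\to\mathcal C$ to the fibre functors $\varphi_{X,i}=\varphi|_{\mathcal C/X}$ and relabelling functions $\gamma_{f,i}=\gamma_{(X,i,f)}$. **Proposition.** Under this isomorphism, a $\mathsf{\tilde D}_m$-algebra corresponds to an operadic category if and only if its algebra structure map in $\mathbf{Cat}_{\ell t}/\!/\mathcal S$ is strict; and a morphism between $\mathsf{\tilde D}_m$-algebras which correspond to operadic categories corresponds to an operadic functor if and only if its underlying map in $\mathbf{Cat}_{\ell t}/\!/\mathcal S$ is strict. -/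

import Mathlib

open CategoryTheory

universe u

noncomputable section

namespace Decalage

/-! ### The category of finite ordinals and arbitrary maps -/

/-- The objects of the category `𝒮`: one finite set `{1, …, n}` (modelled by `Fin n`)
for each natural number `n`. -/
@[ext]
structure FinS : Type where
  /-- The number of elements. -/
  size : ℕ

namespace FinS

/-- Maps of `𝒮` are arbitrary functions. -/
@[ext]
structure Hom (m n : FinS) : Type where
  /-- The underlying function. -/
  toFun : Fin m.size → Fin n.size

instance : Category FinS where
  Hom := Hom
  id _ := ⟨fun x => x⟩
  comp f g := ⟨fun x => g.toFun (f.toFun x)⟩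

@[simp] theorem id_toFun (m : FinS) (x : Fin m.size) : Hom.toFun (𝟙 m) x = x := rfl

@[simp] theorem comp_toFun {l m n : FinS} (f : l ⟶ m) (g : m ⟶ n) (x : Fin l.size) :
    Hom.toFun (f ≫ g) x = g.toFun (f.toFun x) := rfl

theorem hom_ext {m n : FinS} {f g : m ⟶ n} (h : ∀ x, f.toFun x = g.toFun x) : f = g :=
  Hom.ext (funext h)

theorem eqToHom_toFun_val {m n : FinS} (h : m = n) (x : Fin m.size) :
    ((eqToHom h).toFun x : ℕ) = x := by
  subst h; rfl

variable {l m n : FinS}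

/-- The set `{ j | φ j = i }`. -/
def fibreSet (φ : m ⟶ n) (i : Fin n.size) : Finset (Fin m.size) :=
  Finset.univ.filter fun j => φ.toFun j = i

/-- The fibre `φ⁻¹(i)`, as an object of `𝒮`. -/
def fibre (φ : m ⟶ n) (i : Fin n.size) : FinS := ⟨(fibreSet φ i).card⟩

/-- The unique monotone injection `ε_{φ,i} : φ⁻¹(i) ⟶ m` with image `{ j | φ j = i }`. -/
def incl (φ : m ⟶ n) (i : Fin n.size) : fibre φ i ⟶ m :=
  ⟨fun k => (fibreSet φ i).orderEmbOfFin rfl k⟩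

theorem incl_prop (φ : m ⟶ n) (i : Fin n.size) (k : Fin (fibre φ i).size) :
    φ.toFun ((incl φ i).toFun k) = i :=
  (Finset.mem_filter.mp ((fibreSet φ i).orderEmbOfFin_mem rfl k)).2

theorem incl_injective (φ : m ⟶ n) (i : Fin n.size) : Function.Injective (incl φ i).toFun :=
  ((fibreSet φ i).orderEmbOfFin rfl).injective

/-- The position in the fibre `φ⁻¹(i)` of an element `x` with `φ x = i`. -/
def index (φ : m ⟶ n) (i : Fin n.size) (x : Fin m.size) (hx : φ.toFun x = i) :
    Fin (fibre φ i).size :=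
  ((fibreSet φ i).orderIsoOfFin rfl).symm ⟨x, Finset.mem_filter.mpr ⟨Finset.mem_univ _, hx⟩⟩

@[simp] theorem incl_index (φ : m ⟶ n) (i : Fin n.size) (x : Fin m.size) (hx : φ.toFun x = i) :
    (incl φ i).toFun (index φ i x hx) = x := by
  have h := (fibreSet φ i).coe_orderIsoOfFin_apply rfl (index φ i x hx)
  rw [index, OrderIso.apply_symm_apply] at h
  exact h.symm

/-- The map induced on fibres by `a : m ⟶ m'`, if `a` carries elements over `i` to elements
over `i'`: the unique map `k` with `k ≫ ε_{φ',i'} = ε_{φ,i} ≫ a`. -/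
def fibreMap {m' n' : FinS} (φ : m ⟶ n) (φ' : m' ⟶ n') (a : m ⟶ m') (i : Fin n.size)
    (i' : Fin n'.size) (h : ∀ x, φ.toFun x = i → φ'.toFun (a.toFun x) = i') :
    fibre φ i ⟶ fibre φ' i' :=
  ⟨fun k => index φ' i' (a.toFun ((incl φ i).toFun k)) (h _ (incl_prop φ i k))⟩

@[simp] theorem incl_fibreMap {m' n' : FinS} (φ : m ⟶ n) (φ' : m' ⟶ n') (a : m ⟶ m')
    (i : Fin n.size) (i' : Fin n'.size) (h : ∀ x, φ.toFun x = i → φ'.toFun (a.toFun x) = i')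
    (k : Fin (fibre φ i).size) :
    (incl φ' i').toFun ((fibreMap φ φ' a i i' h).toFun k) = a.toFun ((incl φ i).toFun k) :=
  incl_index _ _ _ (h _ (incl_prop φ i k))

theorem comm_apply {φ : l ⟶ m} {ψ : m ⟶ n} {χ : l ⟶ n} (w : φ ≫ ψ = χ) (x : Fin l.size) :
    ψ.toFun (φ.toFun x) = χ.toFun x := by
  subst w; rfl

/-- The fibre functor `𝒮/n ⥤ 𝒮` at `i`: it sends `φ` to `φ⁻¹(i)` and `ψ : φψ ⟶ φ` to the
fibre map `ψ^φ_i`. -/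
def fibreFunctor (n : FinS) (i : Fin n.size) : Over n ⥤ FinS where
  obj φ := fibre φ.hom i
  map {φ χ} ψ := fibreMap φ.hom χ.hom ψ.left i i
    fun x hx => (comm_apply (Over.w ψ) x).trans hx
  map_id φ := hom_ext fun x => incl_injective _ _ (by simp)
  map_comp f g := hom_ext fun x => incl_injective _ _ (by simp)

/-- If `ψ : l ⟶ m`, then `φψ⁻¹(i) ⟶ φ⁻¹(i)` is iterated: the fibre of the fibre map
`ψ^φ_i` at `j` has as many elements as the fibre of `ψ` at `ε j`. -/
theorem fibre_fibreMap (ψ : l ⟶ m) (φ : m ⟶ n) (χ : l ⟶ n) (w : ψ ≫ φ = χ) (i : Fin n.size)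
    (j : Fin (fibre φ i).size) :
    fibre (fibreMap χ φ ψ i i fun x hx => (comm_apply w x).trans hx) j =
      fibre ψ ((incl φ i).toFun j) := by
  apply FinS.ext
  change (fibreSet _ _).card = (fibreSet _ _).card
  refine Finset.card_bij (fun k _ => (incl χ i).toFun k) ?_ ?_ ?_
  · intro k hk
    have hk := (Finset.mem_filter.mp hk).2
    refine Finset.mem_filter.mpr ⟨Finset.mem_univ _, ?_⟩
    rw [← hk, incl_fibreMap]
  · intro a _ b _ h
    exact incl_injective _ _ h
  · intro x hx
    have hx := (Finset.mem_filter.mp hx).2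
    have hχ : χ.toFun x = i := by
      rw [← comm_apply w, hx, incl_prop]
    refine ⟨index χ i x hχ, Finset.mem_filter.mpr ⟨Finset.mem_univ _, ?_⟩, incl_index _ _ _ _⟩
    apply incl_injective
    rw [incl_fibreMap, incl_index, hx]

end FinS

/-! ### Local terminal objects -/

/-- A category endowed with local terminal objects: each connected component comes with a chosen
terminal object of that component. -/
@[ext]
structure LocalTerminals (C : Type u) [SmallCategory C] : Type u where
  /-- The object chosen in a connected component. -/
  chosen : CategoryTheory.ConnectedComponents C → C
  /-- The chosen object lies in its component. -/
  mk_chosen : ∀ c, CategoryTheory.ConnectedComponents.mk (chosen c) = c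
  /-- The chosen object is terminal in its component. -/
  terminal : ∀ (c : CategoryTheory.ConnectedComponents C) (X : C), CategoryTheory.ConnectedComponents.mk X = c →
    Nonempty (Unique (X ⟶ chosen c))

namespace LocalTerminals

variable {C : Type u} [SmallCategory C] (t : LocalTerminals C)

/-- The property of being one of the chosen local terminal objects. -/
def IsChosen (X : C) : Prop := ∃ c, t.chosen c = X

/-- `uX` is the chosen terminal object in the connected component of `X`. -/
def u (X : C) : C := t.chosen (CategoryTheory.ConnectedComponents.mk X)

/-- The unique map `τ_X : X ⟶ uX`. -/
def τ (X : C) : X ⟶ t.u X := (t.terminal _ X rfl).some.default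

variable {t}

theorem isChosen_u (X : C) : t.IsChosen (t.u X) := ⟨_, rfl⟩

theorem mk_eq {X Y : C} (f : X ⟶ Y) : CategoryTheory.ConnectedComponents.mk X = CategoryTheory.ConnectedComponents.mk Y :=
  Quotient.sound (s := Zigzag.setoid C) (Zigzag.of_hom f)

theorem u_eq {X Y : C} (f : X ⟶ Y) : t.u X = t.u Y := congrArg t.chosen (mk_eq f)

theorem IsChosen.u_eq {X : C} (h : t.IsChosen X) : t.u X = X := by
  obtain ⟨c, rfl⟩ := h
  exact congrArg t.chosen (t.mk_chosen c)

theorem hom_ext {X T : C} (hT : t.IsChosen T) (f g : X ⟶ T) : f = g := by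
  obtain ⟨c, rfl⟩ := hT
  have := (t.terminal c X ((mk_eq f).trans (t.mk_chosen c))).some
  exact Subsingleton.elim f g

theorem eq_of_hom {X Y : C} (f : X ⟶ Y) (hX : t.IsChosen X) (hY : t.IsChosen Y) : X = Y :=
  hX.u_eq.symm.trans ((LocalTerminals.u_eq f).trans hY.u_eq)

end LocalTerminals

/-! ### The lax slice categories -/

/-- An object of the lax slice `Cat // 𝒮`: a small category with a functor to `𝒮`. -/
structure CatOverS : Type (u + 1) where
  /-- The underlying category. -/
  C : Type u
  /-- Its category structure. -/
  [cat : SmallCategory C]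
  /-- The cardinality functor `|-|`. -/
  card : C ⥤ FinS

attribute [instance] CatOverS.cat

namespace CatOverS

/-- A map of `Cat // 𝒮`: a functor `F` and a natural transformation `ν : |-| ⟶ |F -|`. -/
structure Hom (A B : CatOverS.{u}) : Type u where
  /-- The functor. -/
  F : A.C ⥤ B.C
  /-- The natural transformation filling the triangle. -/
  ν : A.card ⟶ F ⋙ B.card

variable {A B : CatOverS.{u}}

theorem Hom.ext {f g : Hom A B} (hobj : ∀ X, f.F.obj X = g.F.obj X)
    (hmap : ∀ (X Y : A.C) (k : X ⟶ Y), HEq (f.F.map k) (g.F.map k))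
    (hν : ∀ (X : A.C) (i : Fin (A.card.obj X).size),
      ((f.ν.app X).toFun i : ℕ) = (g.ν.app X).toFun i) : f = g := by
  obtain ⟨F, ν⟩ := f
  obtain ⟨G, ν'⟩ := g
  obtain rfl : F = G := Functor.hext hobj hmap
  congr 1
  ext X : 2
  exact FinS.hom_ext fun i => Fin.ext (hν X i)

instance : Category CatOverS.{u} where
  Hom := Hom
  id A := ⟨𝟭 A.C, 𝟙 _⟩
  comp f g := ⟨f.F ⋙ g.F, f.ν ≫ Functor.whiskerLeft f.F g.ν⟩

end CatOverS

/-- An object of the lax slice `Cat_ℓt // 𝒮`: a small category endowed with local terminal objects,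
and a functor `|-|` to `𝒮` which preserves chosen local terminals; the only chosen
terminal object of `𝒮` is the set with one element. -/
structure CatLtOverS : Type (u + 1) extends CatOverS.{u} where
  /-- The local terminal objects. -/
  lt : LocalTerminals C
  /-- If `X` is a chosen local terminal then `|X| = 1`. -/
  card_chosen : ∀ X, lt.IsChosen X → card.obj X = ⟨1⟩

namespace CatLtOverS

/-- A map of `Cat_ℓt // 𝒮`: a map of `Cat // 𝒮` whose functor preserves chosen local terminals. -/
structure Hom (A B : CatLtOverS.{u}) : Type u
    extends CatOverS.Hom A.toCatOverS B.toCatOverS where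
  /-- Chosen local terminals are preserved. -/
  pres : ∀ X, A.lt.IsChosen X → B.lt.IsChosen (F.obj X)

theorem Hom.ext' {A B : CatLtOverS.{u}} {f g : Hom A B} (h : f.toHom = g.toHom) : f = g := by
  cases f; cases g; congr

instance : Category CatLtOverS.{u} where
  Hom := Hom
  id A := ⟨𝟙 A.toCatOverS, fun _ h => h⟩
  comp {A B C} f g :=
    ⟨CategoryStruct.comp (X := A.toCatOverS) (Y := B.toCatOverS) (Z := C.toCatOverS)
      f.toHom g.toHom, fun X h => g.pres _ (f.pres X h)⟩

theorem hom_ext {A B : CatLtOverS.{u}} {f g : A ⟶ B} (hobj : ∀ X, f.F.obj X = g.F.obj X)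
    (hmap : ∀ (X Y : A.C) (k : X ⟶ Y), HEq (f.F.map k) (g.F.map k))
    (hν : ∀ (X : A.C) (i : Fin (A.card.obj X).size),
      ((f.ν.app X).toFun i : ℕ) = (g.ν.app X).toFun i) : f = g :=
  Hom.ext' (CatOverS.Hom.ext hobj hmap hν)

/-- A map `(F, ν)` of `Cat_ℓt // 𝒮` is *strict* if `ν` is an identity: the triangle of functors
commutes, and `ν` is the identity transformation. -/
def IsStrict {A B : CatLtOverS.{u}} (f : A ⟶ B) : Prop :=
  ∃ h : A.card = f.F ⋙ B.card, f.ν = eqToHom h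

/-- The forgetful functor `Cat_ℓt // 𝒮 ⥤ Cat // 𝒮`. -/
def forget : CatLtOverS.{u} ⥤ CatOverS.{u} where
  obj A := A.toCatOverS
  map f := f.toHom

end CatLtOverS

/-! ### Modified décalage -/

namespace Dm

open FinS

section

variable (A : CatOverS.{u})

/-- The category `D_m(C) = ∑_{X ∈ C, i ∈ |X|} C/X`. -/
abbrev Obj : Type u := Σ p : (Σ X : A.C, Fin (A.card.obj X).size), Over p.1

/-- The functor `D_m(C) ⥤ 𝒮` sending `(X, i, f)` to `|f|⁻¹(i)` and `g : (X, i, fg) ⟶ (X, i, f)`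
to the fibre map `|g|^{|f|}_i`. -/
def card : Obj A ⥤ FinS :=
  Sigma.desc fun p => Over.post A.card ⋙ fibreFunctor (A.card.obj p.1) p.2

/-- The copairing `D_m(C) ⥤ C` of the slice projections. -/
def proj : Obj A ⥤ A.C := Sigma.desc fun p => Over.forget p.1

/-- `D_m(C)` as an object of `Cat // 𝒮`. -/
abbrev toOverS : CatOverS.{u} := ⟨Obj A, card A⟩

end

variable {A B : CatOverS.{u}}

/-- The object `(X, i, f)` of `D_m(C)`. -/
abbrev mk (X : A.C) (i : Fin (A.card.obj X).size) {Y : A.C} (f : Y ⟶ X) : Obj A :=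
  ⟨⟨X, i⟩, Over.mk f⟩

/-- The map `g : (X, i, fg) ⟶ (X, i, f)` of `D_m(C)`. -/
abbrev mkMap (X : A.C) (i : Fin (A.card.obj X).size) {Z Y : A.C} (g : Z ⟶ Y) (f : Y ⟶ X) :
    mk X i (g ≫ f) ⟶ mk X i f :=
  Sigma.SigmaHom.mk (Over.homMk g)

theorem mk_congr {X X' : A.C} {i : Fin (A.card.obj X).size} {i' : Fin (A.card.obj X').size}
    {Y Y' : A.C} {f : Y ⟶ X} {f' : Y' ⟶ X'} (hX : X = X') (hi : (i : ℕ) = i') (hY : Y = Y')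
    (hf : HEq f f') : mk X i f = mk X' i' f' := by
  subst hX hY
  obtain rfl := Fin.ext hi
  obtain rfl := eq_of_heq hf
  rfl

/-- The map of `D_m(C)` given by a map in a slice, up to an equality of the indices. -/
def homOf {a b : Obj A} (h : a.1 = b.1) (g : a.2.left ⟶ b.2.left)
    (w : g ≫ b.2.hom = a.2.hom ≫ eqToHom (congrArg Sigma.fst h)) : a ⟶ b :=
  match a, b, h, g, w with
  | ⟨p, f⟩, ⟨_, f'⟩, rfl, g, w =>
    Sigma.SigmaHom.mk (Over.homMk g (by simpa using w))

theorem proj_homOf {a b : Obj A} (h : a.1 = b.1) (g : a.2.left ⟶ b.2.left)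
    (w : g ≫ b.2.hom = a.2.hom ≫ eqToHom (congrArg Sigma.fst h)) :
    (proj A).map (homOf h g w) = g := by
  obtain ⟨p, f⟩ := a
  obtain ⟨q, f'⟩ := b
  dsimp only at h
  subst h
  rfl

theorem proj_injective {a b : Obj A} {f g : a ⟶ b} (h : (proj A).map f = (proj A).map g) :
    f = g := by
  obtain ⟨p, a⟩ := a
  obtain ⟨f⟩ := f
  obtain ⟨g⟩ := g
  exact congrArg Sigma.SigmaHom.mk (Over.OverMorphism.ext h)

theorem heq_of_proj {a b a' b' : Obj A} (ha : a = a') (hb : b = b') {f : a ⟶ b} {g : a' ⟶ b'}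
    (h : HEq ((proj A).map f) ((proj A).map g)) : HEq f g := by
  subst ha hb
  exact heq_of_eq (proj_injective (eq_of_heq h))

variable (A) in
/-- The chosen local terminals of `D_m(C)` are the objects `(X, i, 1_X)`. -/
def lt : LocalTerminals (Obj A) where
  chosen := Quotient.lift (fun a => mk a.1.1 a.1.2 (𝟙 _)) (fun a b h => by
    have key : ∀ {a b : Obj A}, (a ⟶ b) → a.1 = b.1 := by
      rintro ⟨p, a⟩ ⟨q, b⟩ ⟨f⟩; rfl
    have : a.1 = b.1 := by
      induction h with
      | refl => rfl
      | tail _ h ih =>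
        rw [ih]
        rcases h with ⟨⟨f⟩⟩ | ⟨⟨f⟩⟩
        · exact key f
        · exact (key f).symm
    obtain ⟨p, a⟩ := a
    obtain ⟨q, b⟩ := b
    dsimp only at this
    subst this
    rfl)
  mk_chosen c := by
    induction c using Quotient.inductionOn with
    | h a =>
      obtain ⟨p, f⟩ := a
      exact Quotient.sound (s := Zigzag.setoid _)
        (Zigzag.of_inv (Sigma.SigmaHom.mk (Over.mkIdTerminal.from f)))
  terminal c a h := by
    subst h
    obtain ⟨p, f⟩ := a
    refine ⟨⟨⟨Sigma.SigmaHom.mk (Over.mkIdTerminal.from f)⟩, ?_⟩⟩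
    rintro ⟨g⟩
    exact congrArg Sigma.SigmaHom.mk (Over.mkIdTerminal.hom_ext _ _)

theorem isChosen_mk_id (X : A.C) (i : Fin (A.card.obj X).size) :
    (lt A).IsChosen (mk X i (𝟙 X)) :=
  ⟨CategoryTheory.ConnectedComponents.mk (mk X i (𝟙 X)), rfl⟩

theorem isChosen_iff {a : Obj A} :
    (lt A).IsChosen a ↔ ∃ (X : A.C) (i : Fin (A.card.obj X).size), a = mk X i (𝟙 X) := by
  constructor
  · rintro ⟨c, rfl⟩
    induction c using Quotient.inductionOn with
    | h a => exact ⟨_, _, rfl⟩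
  · rintro ⟨X, i, rfl⟩
    exact isChosen_mk_id X i

theorem val_eq_of_incl {a b : Obj A} (h : a = b) (x : Fin ((card A).obj a).size)
    (y : Fin ((card A).obj b).size)
    (hxy : ((incl (A.card.map a.2.hom) a.1.2).toFun x : ℕ) =
      (incl (A.card.map b.2.hom) b.1.2).toFun y) : (x : ℕ) = y := by
  subst h
  exact congrArg Fin.val (incl_injective _ _ (Fin.ext hxy))

theorem card_one {a : Obj A} (h : (lt A).IsChosen a) : (card A).obj a = ⟨1⟩ := by
  obtain ⟨X, i, rfl⟩ := isChosen_iff.mp h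
  apply FinS.ext
  change (fibreSet _ _).card = 1
  refine Finset.card_eq_one.mpr ⟨i, ?_⟩
  ext j
  have : (A.card.map (𝟙 X)).toFun j = j := by rw [A.card.map_id]; rfl
  refine Finset.mem_filter.trans (Iff.trans ⟨fun h => ?_, fun h => ?_⟩ (Finset.mem_singleton (b := j) (a := i)).symm)
  · exact this.symm.trans h.2
  · exact ⟨Finset.mem_univ _, this.trans h⟩

/-- The injections `ε : |f|⁻¹(i) ⟶ |Y|` are natural in `(X, i, f)`. -/
theorem incl_card_map {a b : Obj A} (g : a ⟶ b) (x : Fin ((card A).obj a).size) :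
    (incl (A.card.map b.2.hom) b.1.2).toFun (((card A).map g).toFun x) =
      (A.card.map ((proj A).map g)).toFun ((incl (A.card.map a.2.hom) a.1.2).toFun x) := by
  obtain ⟨p, a⟩ := a
  obtain ⟨g⟩ := g
  exact incl_fibreMap _ _ _ _ _
    (fun x hx => (comm_apply (Over.w ((Over.post A.card).map g)) x).trans hx) _

variable (A) in
/-- The value at `C` of the cofree functor `Cat // 𝒮 ⥤ Cat_ℓt // 𝒮`: the category `D_m(C)`, with
its chosen terminals `1_X` and its cardinality functor. -/
def cofreeObj : CatLtOverS.{u} where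
  toCatOverS := toOverS A
  lt := lt A
  card_chosen _ h := card_one h

theorem over_carry (f : A ⟶ B) {X Y : A.C} (i : Fin (A.card.obj X).size) (g : Y ⟶ X)
    (y : Fin (A.card.obj Y).size) (hy : (A.card.map g).toFun y = i) :
    (B.card.map (f.F.map g)).toFun ((f.ν.app Y).toFun y) = (f.ν.app X).toFun i := by
  rw [← hy]
  exact comm_apply (f.ν.naturality g).symm y

/-- The functor `(X, i, f) ↦ (FX, ν_X i, Ff)` induced by a map `(F, ν)`. -/
def mapFunctor (f : A ⟶ B) : Obj A ⥤ Obj B :=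
  Sigma.desc fun p => Over.post f.F ⋙
    Sigma.incl (C := fun p : (Σ X : B.C, Fin (B.card.obj X).size) => Over p.1)
      ⟨f.F.obj p.1, (f.ν.app p.1).toFun p.2⟩

theorem proj_mapFunctor_map (f : A ⟶ B) {a b : Obj A} (g : a ⟶ b) :
    (proj B).map ((mapFunctor f).map g) = f.F.map ((proj A).map g) := by
  obtain ⟨p, a⟩ := a
  obtain ⟨g⟩ := g
  rfl

/-- The map `|f|⁻¹(i) ⟶ |Ff|⁻¹(ν_X i)` induced by `ν_Y`. -/
def mapν (f : A ⟶ B) (a : Obj A) : (card A).obj a ⟶ (card B).obj ((mapFunctor f).obj a) :=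
  fibreMap (A.card.map a.2.hom) (B.card.map (f.F.map a.2.hom))
    (f.ν.app a.2.left) a.1.2 ((f.ν.app a.1.1).toFun a.1.2) (over_carry f a.1.2 a.2.hom)

theorem incl_mapν (f : A ⟶ B) (a : Obj A) (x : Fin ((card A).obj a).size) :
    (incl (B.card.map (f.F.map a.2.hom)) ((f.ν.app a.1.1).toFun a.1.2)).toFun
        ((mapν f a).toFun x) =
      (f.ν.app a.2.left).toFun ((incl (A.card.map a.2.hom) a.1.2).toFun x) :=
  incl_fibreMap _ _ _ _ _ (over_carry f a.1.2 a.2.hom) _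

theorem mapν_naturality (f : A ⟶ B) {a b : Obj A} (g : a ⟶ b) :
    (card A).map g ≫ mapν f b = mapν f a ≫ (card B).map ((mapFunctor f).map g) := by
  refine FinS.hom_ext fun x =>
    incl_injective (B.card.map (f.F.map b.2.hom)) ((f.ν.app b.1.1).toFun b.1.2) ?_
  refine (incl_mapν f b _).trans ?_
  refine (congrArg _ (incl_card_map g x)).trans ?_
  refine Eq.trans ?_ (incl_card_map ((mapFunctor f).map g) ((mapν f a).toFun x)).symm
  rw [proj_mapFunctor_map]
  refine (comm_apply (f.ν.naturality ((proj A).map g)).symm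
    ((incl (A.card.map a.2.hom) a.1.2).toFun x)).symm.trans ?_
  exact congrArg (B.card.map (f.F.map ((proj A).map g))).toFun (incl_mapν f a x).symm

/-- The action of the cofree functor on maps: `(F, ν)` is sent to the functor
`(X, i, f) ↦ (FX, ν_X i, Ff)`, with the maps `|f|⁻¹(i) ⟶ |Ff|⁻¹(ν_X i)` induced by `ν`. -/
def cofreeMap (f : A ⟶ B) : cofreeObj A ⟶ cofreeObj B where
  F := mapFunctor f
  ν := { app := mapν f, naturality := fun _ _ g => mapν_naturality f g }
  pres a h := by
    obtain ⟨X, i, rfl⟩ := isChosen_iff.mp h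
    refine isChosen_iff.mpr ⟨f.F.obj X, (f.ν.app X).toFun i, ?_⟩
    exact mk_congr rfl rfl rfl (heq_of_eq (f.F.map_id X))

/-- The cofree functor `Cat // 𝒮 ⥤ Cat_ℓt // 𝒮`. -/
def cofree : CatOverS.{u} ⥤ CatLtOverS.{u} where
  obj := cofreeObj
  map := cofreeMap
  map_id A := by
    refine CatLtOverS.hom_ext (fun _ => rfl) ?_ ?_
    · rintro ⟨p, a⟩ ⟨_, b⟩ ⟨g⟩
      rfl
    · intro a x
      refine congrArg Fin.val ?_
      exact incl_injective _ _ (incl_mapν (𝟙 A) a x)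
  map_comp f g := by
    refine CatLtOverS.hom_ext (fun _ => rfl) ?_ ?_
    · rintro ⟨p, a⟩ ⟨_, b⟩ ⟨h⟩
      rfl
    · intro a x
      refine congrArg Fin.val ?_
      refine incl_injective _ _ ((incl_mapν (f ≫ g) a x).trans ?_)
      refine Eq.trans ?_ (incl_mapν g ((mapFunctor f).obj a) _).symm
      exact congrArg _ (incl_mapν f a x).symm

/-- The counit of the forgetful--cofree adjunction: the copairing of the slice projections, with
the natural transformation whose components are the injections `ε : |f|⁻¹(i) ⟶ |Y|`. -/
def counit : cofree.{u} ⋙ CatLtOverS.forget.{u} ⟶ 𝟭 CatOverS.{u} where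
  app A :=
    { F := proj A
      ν :=
        { app := fun a => incl (A.card.map a.2.hom) a.1.2
          naturality := fun a b g => FinS.hom_ext fun x => incl_card_map g x } }
  naturality A B f := by
    refine CatOverS.Hom.ext (fun _ => rfl) ?_ ?_
    · rintro ⟨p, a⟩ ⟨_, b⟩ ⟨g⟩
      rfl
    · intro a x
      exact congrArg Fin.val (incl_mapν f a x)

section unit

variable {A : CatLtOverS.{u}}

/-- The unique element of `|T|`, for `T` a chosen local terminal. -/
def elt {T : A.C} (h : A.lt.IsChosen T) : Fin (A.card.obj T).size :=
  ⟨0, by rw [A.card_chosen T h]; exact Nat.one_pos⟩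

/-- The unique element of `|uX|`. -/
def star (X : A.C) : Fin (A.card.obj (A.lt.u X)).size := elt (LocalTerminals.isChosen_u X)

theorem eq_of_isChosen {T : A.C} (h : A.lt.IsChosen T) (i j : Fin (A.card.obj T).size) : i = j := by
  have h1 : (A.card.obj T).size = 1 := congrArg FinS.size (A.card_chosen _ h)
  apply Fin.ext
  have := i.2
  have := j.2
  omega

theorem star_val {X : A.C} (i : Fin (A.card.obj (A.lt.u X)).size) : i = star X :=
  eq_of_isChosen (LocalTerminals.isChosen_u X) _ _

theorem fibre_of_isChosen {X T : A.C} (h : A.lt.IsChosen T) (f : X ⟶ T)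
    (i : Fin (A.card.obj T).size) : fibreSet (A.card.map f) i = Finset.univ :=
  Finset.filter_true_of_mem fun _ _ => eq_of_isChosen h _ _

theorem incl_of_isChosen {X T : A.C} (h : A.lt.IsChosen T) (f : X ⟶ T)
    (i : Fin (A.card.obj T).size) (x : Fin (fibre (A.card.map f) i).size) :
    ((incl (A.card.map f) i).toFun x : ℕ) = x := by
  have hc : (fibreSet (A.card.map f) i).card = (A.card.obj X).size := by
    rw [fibre_of_isChosen h, Finset.card_univ, Fintype.card_fin]
  have := Finset.orderEmbOfFin_unique (s := fibreSet (A.card.map f) i) rfl (f := Fin.cast hc)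
    (fun y => Finset.mem_filter.mpr ⟨Finset.mem_univ _, eq_of_isChosen h _ _⟩) (Fin.cast_strictMono hc)
  exact (congrArg Fin.val (congrFun this x)).symm

theorem card_τ (X : A.C) : A.card.obj X = fibre (A.card.map (A.lt.τ X)) (star X) := by
  apply FinS.ext
  change _ = (fibreSet _ _).card
  rw [fibre_of_isChosen (LocalTerminals.isChosen_u X)]
  simp

theorem index_eq {X Y : A.C} (f : X ⟶ Y) :
    (⟨A.lt.u X, star X⟩ : Σ X : A.C, Fin (A.card.obj X).size) = ⟨A.lt.u Y, star Y⟩ := by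
  have key : ∀ {S T : A.C} (hST : S = T) (_ : A.lt.IsChosen T) (i : Fin (A.card.obj S).size)
      (j : Fin (A.card.obj T).size),
      (⟨S, i⟩ : Σ X : A.C, Fin (A.card.obj X).size) = ⟨T, j⟩ := by
    rintro S _ rfl h i j
    rw [eq_of_isChosen h i j]
  exact key (LocalTerminals.u_eq f) (LocalTerminals.isChosen_u Y) _ _

variable (A) in
/-- The functor `C ⥤ D_m(C)` sending `X` to `(uX, 1, τ_X)` and `f` to `f`. -/
def unitFunctor : A.C ⥤ Obj A.toCatOverS where
  obj X := mk (A.lt.u X) (star X) (A.lt.τ X)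
  map f := homOf (index_eq f) f (LocalTerminals.hom_ext (LocalTerminals.isChosen_u _) _ _)
  map_id X := proj_injective ((proj_homOf _ _ _).trans
    ((proj A.toCatOverS).map_id (mk (A.lt.u X) (star X) (A.lt.τ X))).symm)
  map_comp f g := proj_injective ((proj_homOf _ _ _).trans (by
    rw [(proj A.toCatOverS).map_comp, proj_homOf, proj_homOf]; rfl))

theorem heq_of_isChosen {X S T : A.C} (h : S = T) (hT : A.lt.IsChosen T) (f : X ⟶ S)
    (g : X ⟶ T) : HEq f g := by
  subst h
  exact heq_of_eq (LocalTerminals.hom_ext hT f g)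

theorem fin_val_of_isChosen {S T : A.C} (h : S = T) (hT : A.lt.IsChosen T)
    (i : Fin (A.card.obj S).size) (j : Fin (A.card.obj T).size) : (i : ℕ) = j := by
  subst h
  exact congrArg Fin.val (eq_of_isChosen hT i j)

/-- An object `(T, i, f)` of `D_m(C)` with `T` a chosen local terminal is `(uX, 1, τ_X)`. -/
theorem mk_eq_unit {X T : A.C} (hT : A.lt.IsChosen T) (i : Fin (A.card.obj T).size) (f : X ⟶ T) :
    (unitFunctor A).obj X = mk T i f := by
  have h : A.lt.u X = T := (LocalTerminals.u_eq f).trans hT.u_eq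
  exact mk_congr h (fin_val_of_isChosen h hT _ _) rfl (heq_of_isChosen h hT _ _)

theorem proj_unitFunctor_map {X Y : A.C} (f : X ⟶ Y) :
    (proj A.toCatOverS).map ((unitFunctor A).map f) = f :=
  proj_homOf _ _ _

theorem eqToHom_card_τ {X Y : A.C} (f : X ⟶ Y) :
    A.card.map f ≫ eqToHom (card_τ Y) =
      eqToHom (card_τ X) ≫ (card A.toCatOverS).map ((unitFunctor A).map f) := by
  have key : ∀ (X : A.C) (x : Fin (A.card.obj X).size),
      (incl (A.card.map (A.lt.τ X)) (star X)).toFun ((eqToHom (card_τ X)).toFun x) = x :=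
    fun X x => Fin.ext ((incl_of_isChosen (LocalTerminals.isChosen_u X) _ _ _).trans
      (eqToHom_toFun_val (card_τ X) x))
  refine FinS.hom_ext fun x => incl_injective (A.card.map (A.lt.τ Y)) (star Y) ?_
  refine (key Y _).trans (Eq.trans ?_ (incl_card_map ((unitFunctor A).map f) _).symm)
  rw [proj_unitFunctor_map]
  exact congrArg (A.card.map f).toFun (key X x).symm

end unit

/-- The unit of the forgetful--cofree adjunction: the functor `X ↦ (uX, 1, τ_X)`, with the
identity transformation given by `|X| = |τ_X|⁻¹(1)`. -/
def unit : 𝟭 CatLtOverS.{u} ⟶ CatLtOverS.forget.{u} ⋙ cofree.{u} where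
  app A :=
    { F := unitFunctor A
      ν := { app := fun X => eqToHom (card_τ X), naturality := fun _ _ f => eqToHom_card_τ f }
      pres := fun X h => isChosen_iff.mpr
        ⟨X, elt h, mk_eq_unit h _ _⟩ }
  naturality A B f := by
    refine CatLtOverS.hom_ext ?_ ?_ ?_
    · intro X
      exact mk_eq_unit (f.pres _ (LocalTerminals.isChosen_u X)) _ _
    · intro X Y g
      refine heq_of_proj ?_ ?_ ?_
      · exact mk_eq_unit (f.pres _ (LocalTerminals.isChosen_u X)) _ _
      · exact mk_eq_unit (f.pres _ (LocalTerminals.isChosen_u Y)) _ _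
      · refine heq_of_eq ((proj_unitFunctor_map (A := B) (f.F.map g)).trans ?_)
        refine Eq.trans ?_ (proj_mapFunctor_map f.toHom ((unitFunctor A).map g)).symm
        exact congrArg f.F.map (proj_unitFunctor_map g).symm
    · intro X x
      refine (eqToHom_toFun_val (card_τ (A := B) (f.F.obj X)) _).trans ?_
      have h1 := incl_of_isChosen (f.pres _ (LocalTerminals.isChosen_u X)) (f.F.map (A.lt.τ X))
        ((f.ν.app _).toFun (star X))
        ((mapν f.toHom ((unitFunctor A).obj X)).toFun ((eqToHom (card_τ X)).toFun x))
      refine Eq.trans ?_ h1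
      refine congrArg Fin.val (Eq.trans ?_
        (incl_mapν f.toHom ((unitFunctor A).obj X) ((eqToHom (card_τ X)).toFun x)).symm)
      refine congrArg (f.ν.app X).toFun (Fin.ext ?_)
      exact ((incl_of_isChosen (LocalTerminals.isChosen_u X) _ _ _).trans
        (eqToHom_toFun_val (card_τ X) x)).symm

/-- The forgetful--cofree adjunction between `Cat_ℓt // 𝒮` (the category of coalgebras for the
modified décalage comonad on `Cat // 𝒮`) and `Cat // 𝒮`. -/
def adj : CatLtOverS.forget.{u} ⊣ cofree.{u} :=
  Adjunction.mkOfUnitCounit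
    { unit := unit
      counit := counit
      left_triangle := by
        ext A : 2
        refine CatOverS.Hom.ext (fun _ => rfl) ?_ ?_
        · intro X Y f
          exact heq_of_eq (proj_unitFunctor_map f)
        · intro X x
          exact (incl_of_isChosen (A := A) (LocalTerminals.isChosen_u X) _ _ _).trans
            (eqToHom_toFun_val (card_τ X) x)
      right_triangle := by
        ext A : 2
        have hobj : ∀ a : Obj A, (mapFunctor (counit.app A)).obj
            ((unitFunctor (cofreeObj A)).obj a) = a := by
          rintro ⟨⟨X, i⟩, a⟩
          have hτ : (lt A).τ ⟨⟨X, i⟩, a⟩ = ((Sigma.incl (C := fun p :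
              (Σ X : A.C, Fin (A.card.obj X).size) => Over p.1) ⟨X, i⟩).map
                (Over.mkIdTerminal.from a) : (⟨⟨X, i⟩, a⟩ : Obj A) ⟶ mk X i (𝟙 X)) :=
            LocalTerminals.hom_ext (isChosen_mk_id X i) _ _
          have hi : ∀ k : Fin (fibre (A.card.map (𝟙 X)) i).size,
              (incl (A.card.map (𝟙 X)) i).toFun k = i := fun k => by
            have h1 : ∀ z, (A.card.map (𝟙 X)).toFun z = z := fun z => by
              rw [A.card.map_id]; rfl
            exact (h1 _).symm.trans (incl_prop (A.card.map (𝟙 X)) i k)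
          refine mk_congr (f' := a.hom) rfl (congrArg Fin.val (hi _)) rfl (heq_of_eq ?_)
          have h2 : (proj A).map ((lt A).τ ⟨⟨X, i⟩, a⟩) = a.hom := by
            rw [hτ]
            have h3 := Over.w (Over.mkIdTerminal.from a)
            exact (Category.comp_id _).symm.trans h3
          exact h2
        refine CatLtOverS.hom_ext hobj ?_ ?_
        · intro a b f
          refine heq_of_proj (hobj a) (hobj b) (heq_of_eq ?_)
          refine (proj_mapFunctor_map (counit.app A)
            ((unitFunctor (cofreeObj A)).map f)).trans ?_
          exact congrArg (proj A).map (proj_unitFunctor_map (A := cofreeObj A) f)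
        · intro a x
          refine val_eq_of_incl (hobj a) _ _ ?_
          refine (congrArg Fin.val (incl_mapν (counit.app A) ((unitFunctor (cofreeObj A)).obj a)
            ((eqToHom (card_τ (A := cofreeObj A) a)).toFun x))).trans ?_
          refine congrArg (fun z => ((incl (A.card.map a.2.hom) a.1.2).toFun z : ℕ)) (Fin.ext ?_)
          exact (incl_of_isChosen (A := cofreeObj A) (LocalTerminals.isChosen_u a) _ _ _).trans
            (eqToHom_toFun_val (card_τ (A := cofreeObj A) a) x) }

end Dm

/-- The modified décalage monad on `Cat_ℓt // 𝒮`: the monad induced by the forgetful--cofree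
adjunction. -/
def modifiedDecalageMonad : Monad CatLtOverS.{u} := Dm.adj.toMonad

/-! ### Operadic and lax-operadic categories -/

open FinS

/-- The data common to operadic and lax-operadic categories: a small category with local terminal
objects, a cardinality functor to `𝒮` which sends chosen local terminals to `1`, and a functor
`φ_{X,i} : C/X ⥤ C` for each object `X` and each `i ∈ |X|`. -/
structure FibreData : Type (u + 1) extends CatLtOverS.{u} where
  /-- The fibre functors. -/
  fib : ∀ (X : C) (_ : Fin (card.obj X).size), Over X ⥤ C

namespace FibreData

variable (P : FibreData.{u}) {X Y Z : P.C}

/-- The fibre `f⁻¹(i)`. -/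
abbrev fibObj (f : Y ⟶ X) (i : Fin (P.card.obj X).size) : P.C := (P.fib X i).obj (Over.mk f)

/-- The fibre map `g^f_i : (fg)⁻¹(i) ⟶ f⁻¹(i)`. -/
abbrev fibMap (g : Z ⟶ Y) (f : Y ⟶ X) (i : Fin (P.card.obj X).size) :
    P.fibObj (g ≫ f) i ⟶ P.fibObj f i :=
  (P.fib X i).map (Over.homMk g)

/-- The fibre map `|g|^{|f|}_i : |fg|⁻¹(i) ⟶ |f|⁻¹(i)` in `𝒮`. -/
abbrev cardFibMap (g : Z ⟶ Y) (f : Y ⟶ X) (i : Fin (P.card.obj X).size) :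
    fibre (P.card.map (g ≫ f)) i ⟶ fibre (P.card.map f) i :=
  fibreMap (P.card.map (g ≫ f)) (P.card.map f) (P.card.map g) i i
    fun x hx => (comm_apply (P.card.map_comp g f).symm x).trans hx

end FibreData

/-- A lax-operadic category. Equality of maps whose domains and codomains are equal only
by previous clauses is expressed by `HEq`. -/
structure LaxOpCat : Type (u + 1) extends FibreData.{u} where
  /-- The relabelling functions `γ_{f,i} : |f|⁻¹(i) ⟶ |f⁻¹(i)|`. -/
  γ : ∀ {X Y : C} (f : Y ⟶ X) (i : Fin (card.obj X).size),
    fibre (card.map f) i ⟶ card.obj (toFibreData.fibObj f i)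
  /-- `(1_X)⁻¹(i)` is a chosen terminal. -/
  fibObj_id : ∀ (X : C) (i : Fin (card.obj X).size), lt.IsChosen (toFibreData.fibObj (𝟙 X) i)
  /-- `|g^f_i| ∘ γ_{fg,i} = γ_{f,i} ∘ |g|^{|f|}_i`. -/
  γ_fibMap : ∀ {X Y Z : C} (g : Z ⟶ Y) (f : Y ⟶ X) (i : Fin (card.obj X).size),
    γ (g ≫ f) i ≫ card.map (toFibreData.fibMap g f i) = toFibreData.cardFibMap g f i ≫ γ f i
  /-- `τ_X⁻¹(*) = X`. -/
  fibObj_τ : ∀ (X : C) (i : Fin (card.obj (lt.u X)).size), toFibreData.fibObj (lt.τ X) i = X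
  /-- `f^{τ_X}_* = f`. -/
  fibMap_τ : ∀ {X Y : C} (f : Y ⟶ X) (i : Fin (card.obj (lt.u X)).size),
    HEq (toFibreData.fibMap f (lt.τ X) i) f
  /-- The function `γ_{τ_X,*} : |X| = |τ_X|⁻¹(*) ⟶ |τ_X⁻¹(*)| = |X|` is the identity. -/
  γ_τ : ∀ (X : C) (i : Fin (card.obj (lt.u X)).size) (x : Fin (fibre (card.map (lt.τ X)) i).size),
    ((γ (lt.τ X) i).toFun x : ℕ) = x
  /-- `(g^f_i)⁻¹(γ j) = g⁻¹(ε j)`. -/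
  fibObj_fibMap : ∀ {X Y Z : C} (g : Z ⟶ Y) (f : Y ⟶ X) (i : Fin (card.obj X).size)
    (j : Fin (fibre (card.map f) i).size),
    toFibreData.fibObj (toFibreData.fibMap g f i) ((γ f i).toFun j) =
      toFibreData.fibObj g ((incl (card.map f) i).toFun j)
  /-- `γ_{g^f_i, γ j} ∘ γ̄_{fg,i} = γ_{g, ε j}`, modulo the equality
  `(|g|^{|f|}_i)⁻¹(j) = |g|⁻¹(ε j)`, where `γ̄_{fg,i} : (|g|^{|f|}_i)⁻¹(j) ⟶ |g^f_i|⁻¹(γ j)` is the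
  map of fibres induced by `γ_{fg,i}`. -/
  γ_γ : ∀ {X Y Z : C} (g : Z ⟶ Y) (f : Y ⟶ X) (i : Fin (card.obj X).size)
    (j : Fin (fibre (card.map f) i).size)
    (k : Fin (fibre (toFibreData.cardFibMap g f i) j).size),
    ((γ (toFibreData.fibMap g f i) ((γ f i).toFun j)).toFun
      ((fibreMap (toFibreData.cardFibMap g f i) (card.map (toFibreData.fibMap g f i))
        (γ (g ≫ f) i) j ((γ f i).toFun j)
        fun x hx => (comm_apply (γ_fibMap g f i) x).trans (congrArg (γ f i).toFun hx)).toFun k) :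
        ℕ) =
    (γ g ((incl (card.map f) i).toFun j)).toFun
      ((eqToHom (fibre_fibreMap _ _ _ (card.map_comp g f).symm i j)).toFun k)
  /-- `(h^{fg}_i)^{g^f_i}_{γ j} = h^g_{ε j}`. -/
  fibMap_fibMap : ∀ {X Y Z W : C} (h : W ⟶ Z) (g : Z ⟶ Y) (f : Y ⟶ X)
    (i : Fin (card.obj X).size) (j : Fin (fibre (card.map f) i).size),
    HEq (toFibreData.fibMap (toFibreData.fibMap h (g ≫ f) i) (toFibreData.fibMap g f i)
      ((γ f i).toFun j)) (toFibreData.fibMap h g ((incl (card.map f) i).toFun j))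

/-- An operadic category. Equality of maps whose domains and codomains are equal only
by previous clauses is expressed by `HEq`. -/
structure OpCat : Type (u + 1) extends FibreData.{u} where
  /-- `(1_X)⁻¹(i)` is a chosen terminal. -/
  fibObj_id : ∀ (X : C) (i : Fin (card.obj X).size), lt.IsChosen (toFibreData.fibObj (𝟙 X) i)
  /-- `|f⁻¹(i)| = |f|⁻¹(i)`. -/
  card_fibObj : ∀ {X Y : C} (f : Y ⟶ X) (i : Fin (card.obj X).size),
    card.obj (toFibreData.fibObj f i) = fibre (card.map f) i
  /-- `|g^f_i| = |g|^{|f|}_i`. -/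
  card_fibMap : ∀ {X Y Z : C} (g : Z ⟶ Y) (f : Y ⟶ X) (i : Fin (card.obj X).size),
    HEq (card.map (toFibreData.fibMap g f i)) (toFibreData.cardFibMap g f i)
  /-- `τ_X⁻¹(*) = X`. -/
  fibObj_τ : ∀ (X : C) (i : Fin (card.obj (lt.u X)).size), toFibreData.fibObj (lt.τ X) i = X
  /-- `f^{τ_X}_* = f`. -/
  fibMap_τ : ∀ {X Y : C} (f : Y ⟶ X) (i : Fin (card.obj (lt.u X)).size),
    HEq (toFibreData.fibMap f (lt.τ X) i) f
  /-- `(g^f_i)⁻¹(j) = g⁻¹(ε j)`, for `j ∈ |f|⁻¹(i) = |f⁻¹(i)|`. -/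
  fibObj_fibMap : ∀ {X Y Z : C} (g : Z ⟶ Y) (f : Y ⟶ X) (i : Fin (card.obj X).size)
    (j : Fin (fibre (card.map f) i).size),
    toFibreData.fibObj (toFibreData.fibMap g f i) ((eqToHom (card_fibObj f i).symm).toFun j) =
      toFibreData.fibObj g ((incl (card.map f) i).toFun j)
  /-- `(h^{fg}_i)^{g^f_i}_j = h^g_{ε j}`. -/
  fibMap_fibMap : ∀ {X Y Z W : C} (h : W ⟶ Z) (g : Z ⟶ Y) (f : Y ⟶ X)
    (i : Fin (card.obj X).size) (j : Fin (fibre (card.map f) i).size),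
    HEq (toFibreData.fibMap (toFibreData.fibMap h (g ≫ f) i) (toFibreData.fibMap g f i)
      ((eqToHom (card_fibObj f i).symm).toFun j))
      (toFibreData.fibMap h g ((incl (card.map f) i).toFun j))

/-- A lax-operadic functor: a functor `F` preserving chosen local terminals, with a natural family
of functions `ν_X : |X| ⟶ |FX|`, compatible with fibres, fibre maps and relabelling functions. -/
structure LaxOpCat.Hom (L M : LaxOpCat.{u}) : Type u
    extends toLtHom : CatLtOverS.Hom L.toCatLtOverS M.toCatLtOverS where
  /-- `F(f⁻¹(i)) = (Ff)⁻¹(ν_X i)`. -/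
  map_fibObj : ∀ {X Y : L.C} (f : Y ⟶ X) (i : Fin (L.card.obj X).size),
    F.obj (L.fibObj f i) = M.fibObj (F.map f) ((ν.app X).toFun i)
  /-- `F(g^f_i) = (Fg)^{Ff}_{ν_X i}`. -/
  map_fibMap : ∀ {X Y Z : L.C} (g : Z ⟶ Y) (f : Y ⟶ X) (i : Fin (L.card.obj X).size),
    HEq (F.map (L.fibMap g f i)) (M.fibMap (F.map g) (F.map f) ((ν.app X).toFun i))
  /-- `ν_{f⁻¹(i)} ∘ γ_{f,i} = γ_{Ff, ν_X i} ∘ ν̄`, where `ν̄ : |f|⁻¹(i) ⟶ |Ff|⁻¹(ν_X i)` is the map of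
  fibres induced by `ν_Y`. -/
  map_γ : ∀ {X Y : L.C} (f : Y ⟶ X) (i : Fin (L.card.obj X).size)
    (x : Fin (fibre (L.card.map f) i).size),
    ((ν.app (L.fibObj f i)).toFun ((L.γ f i).toFun x) : ℕ) =
      (M.γ (F.map f) ((ν.app X).toFun i)).toFun
        ((fibreMap (L.card.map f) (M.card.map (F.map f)) (ν.app Y) i ((ν.app X).toFun i)
          fun y hy => (comm_apply (ν.naturality f).symm y).trans
            (congrArg (ν.app X).toFun hy)).toFun x)

/-- An operadic functor: a functor which preserves chosen local terminals, commutes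
strictly with the cardinality functors, and preserves fibres and fibre maps. -/
structure OpCat.Hom (O P : OpCat.{u}) : Type u where
  /-- The underlying functor. -/
  F : O.C ⥤ P.C
  /-- Chosen local terminals are preserved. -/
  pres : ∀ X, O.lt.IsChosen X → P.lt.IsChosen (F.obj X)
  /-- The functor commutes with cardinalities. -/
  card_comp : O.card = F ⋙ P.card
  /-- `F(f⁻¹(i)) = (Ff)⁻¹(i)`, for `i ∈ |X| = |FX|`. -/
  map_fibObj : ∀ {X Y : O.C} (f : Y ⟶ X) (i : Fin (O.card.obj X).size),
    F.obj (O.fibObj f i) =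
      P.fibObj (F.map f) ((eqToHom (Functor.congr_obj card_comp X)).toFun i)
  /-- `F(g^f_i) = (Fg)^{Ff}_i`. -/
  map_fibMap : ∀ {X Y Z : O.C} (g : Z ⟶ Y) (f : Y ⟶ X) (i : Fin (O.card.obj X).size),
    HEq (F.map (O.fibMap g f i))
      (P.fibMap (F.map g) (F.map f) ((eqToHom (Functor.congr_obj card_comp X)).toFun i))

/-! ### Algebras for the modified décalage monad as lax-operadic categories -/

namespace Dm

theorem heq_map {C D : Type u} [SmallCategory C] [SmallCategory D] (F : C ⥤ D) {X Y X' Y' : C}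
    (hX : X = X') (hY : Y = Y') {f : X ⟶ Y} {g : X' ⟶ Y'} (h : HEq f g) :
    HEq (F.map f) (F.map g) := by
  subst hX hY
  exact heq_of_eq (congrArg F.map (eq_of_heq h))

section

variable {A : CatOverS.{u}}

/-- Every map of `D_m(C)` with target `(X, i, f)` is of the form `g : (X, i, fg) ⟶ (X, i, f)`. -/
theorem hom_cases {X : A.C} {i : Fin (A.card.obj X).size} {Y : A.C} {f : Y ⟶ X}
    {motive : ∀ V : Obj A, (V ⟶ mk X i f) → Prop}
    (h : ∀ (Z : A.C) (g : Z ⟶ Y), motive (mk X i (g ≫ f)) (mkMap X i g f))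
    (V : Obj A) (k : V ⟶ mk X i f) : motive V k := by
  obtain ⟨p, a⟩ := V
  obtain ⟨k⟩ := k
  obtain ⟨Z, ⟨⟨⟩⟩, a⟩ := a
  obtain ⟨g, hg, rfl⟩ : ∃ (g : Z ⟶ Y) (hg : g ≫ f = a), k = Over.homMk g hg :=
    ⟨k.left, Over.w k, rfl⟩
  subst hg
  exact h Z g

end

theorem natTrans_val {C : Type u} [SmallCategory C] {F G : C ⥤ FinS} (α : F ⟶ G) {a b : C}
    (h : a = b) {x : Fin (F.obj a).size} {y : Fin (F.obj b).size} (hxy : (x : ℕ) = y) :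
    ((α.app a).toFun x : ℕ) = (α.app b).toFun y := by
  subst h
  rw [Fin.ext hxy]

/-- A strictly monotone function between sets of the same size is the identity. -/
theorem val_of_strictMono {m n : ℕ} (h : m = n) (f : Fin m → Fin n) (hf : StrictMono f)
    (x : Fin m) : (f x : ℕ) = x := by
  subst h
  have := (hf.range_inj strictMono_id).mp (by
    rw [(Finite.injective_iff_surjective.mp hf.injective).range_eq, Set.range_id])
  rw [this]
  rfl

theorem incl_strictMono {m n : FinS} (φ : m ⟶ n) (i : Fin n.size) :
    StrictMono (incl φ i).toFun := ((fibreSet φ i).orderEmbOfFin rfl).strictMono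

end Dm

namespace FibreData

variable (P : FibreData.{u})

/-- The copairing `D_m(C) ⥤ C` of the fibre functors. -/
def φ : Dm.Obj P.toCatOverS ⥤ P.C := Sigma.desc fun p => P.fib p.1 p.2

end FibreData

section structureMaps

variable {P Q : FibreData.{u}} (a : Dm.cofreeObj P.toCatOverS ⟶ P.toCatLtOverS)
  (b : Dm.cofreeObj Q.toCatOverS ⟶ Q.toCatLtOverS)

open Dm

theorem unit_iff (ha : a.F = P.φ) :
    unit.app P.toCatLtOverS ≫ a = 𝟙 P.toCatLtOverS ↔
      (∀ (X : P.C) (i : Fin (P.card.obj (P.lt.u X)).size), P.fibObj (P.lt.τ X) i = X) ∧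
      (∀ {X Y : P.C} (f : Y ⟶ X) (i : Fin (P.card.obj (P.lt.u X)).size),
        HEq (P.fibMap f (P.lt.τ X) i) f) ∧
      (∀ (X : P.C) (i : Fin (P.card.obj (P.lt.u X)).size)
        (x : Fin (fibre (P.card.map (P.lt.τ X)) i).size),
        ((a.ν.app (mk (P.lt.u X) i (P.lt.τ X))).toFun x : ℕ) = x) := by
  obtain ⟨⟨F, γ⟩, pres⟩ := a
  dsimp only at ha
  subst ha
  have hobj : ∀ (X : P.C) (i : Fin (P.card.obj (P.lt.u X)).size),
      (unitFunctor P.toCatLtOverS).obj X = mk (P.lt.u X) i (P.lt.τ X) := fun X i =>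
    mk_eq_unit (LocalTerminals.isChosen_u X) i _
  have hmap : ∀ {X Y : P.C} (f : Y ⟶ X) (i : Fin (P.card.obj (P.lt.u X)).size),
      HEq (P.φ.map ((unitFunctor P.toCatLtOverS).map f)) (P.fibMap f (P.lt.τ X) i) := by
    intro X Y f i
    have h1 := mk_eq_unit (A := P.toCatLtOverS) (LocalTerminals.isChosen_u X) i (f ≫ P.lt.τ X)
    refine heq_map P.φ (g := mkMap (A := P.toCatOverS) (P.lt.u X) i f (P.lt.τ X)) h1 (hobj X i) ?_
    exact heq_of_proj h1 (hobj X i) (heq_of_eq (proj_unitFunctor_map f))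
  constructor
  · intro h
    have h1 : ∀ X : P.C, P.φ.obj ((unitFunctor P.toCatLtOverS).obj X) = X := fun X =>
      congrArg (fun m : P.toCatLtOverS ⟶ P.toCatLtOverS => m.F.obj X) h
    have h2 : ∀ {X Y : P.C} (f : Y ⟶ X), HEq (P.φ.map ((unitFunctor P.toCatLtOverS).map f)) f :=
      fun f => congr_arg_heq (fun m : P.toCatLtOverS ⟶ P.toCatLtOverS => m.F.map f) h
    have h3 : ∀ (X : P.C) (x : Fin (P.card.obj X).size),
        ((γ.app ((unitFunctor P.toCatLtOverS).obj X)).toFun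
          ((eqToHom (card_τ (A := P.toCatLtOverS) X)).toFun x) : ℕ) = x := fun X x =>
      congrArg (fun m : P.toCatLtOverS ⟶ P.toCatLtOverS => ((m.ν.app X).toFun x : ℕ)) h
    refine ⟨fun X i => (congrArg P.φ.obj (hobj X i)).symm.trans (h1 X),
      fun f i => (hmap f i).symm.trans (h2 f), fun X i x => ?_⟩
    have hX : P.card.obj X = fibre (P.card.map (P.lt.τ X)) i := by
      rw [star_val (A := P.toCatLtOverS) i]
      exact card_τ (A := P.toCatLtOverS) X
    refine Eq.trans ?_ ((h3 X (Fin.cast (congrArg FinS.size hX).symm x)).trans rfl)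
    refine natTrans_val γ (hobj X i).symm ?_
    exact (eqToHom_toFun_val (card_τ (A := P.toCatLtOverS) X)
      (Fin.cast (congrArg FinS.size hX).symm x)).symm
  · rintro ⟨h1, h2, h3⟩
    refine CatLtOverS.hom_ext (fun X => h1 X (star X))
      (fun X Y f => (hmap f (star Y)).trans (h2 f _)) (fun X x => ?_)
    exact (h3 X (star X) _).trans (eqToHom_toFun_val (card_τ (A := P.toCatLtOverS) X) x)

/-- The map `(|g|^{|f|}_i)⁻¹(j) ⟶ |g|⁻¹(ε j)` underlying the multiplication is monotone,
hence the identity. -/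
theorem mult_val {X Y Z : P.C} (g : Z ⟶ Y) (f : Y ⟶ X) (i : Fin (P.card.obj X).size)
    (j : Fin (fibre (P.card.map f) i).size) (k : Fin (fibre (P.cardFibMap g f i) j).size) :
    ((mapν (counit.app P.toCatOverS) (mk (A := toOverS P.toCatOverS) (mk X i f) j
      (mkMap X i g f))).toFun k : ℕ) = k := by
  refine val_of_strictMono (congrArg FinS.size
    (fibre_fibreMap (P.card.map g) (P.card.map f) _ (P.card.map_comp g f).symm i j)) _ ?_ k
  intro k k' hk
  have h := fun z => incl_mapν (counit.app P.toCatOverS)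
    (mk (A := toOverS P.toCatOverS) (mk X i f) j (mkMap X i g f)) z
  refine (incl_strictMono (P.card.map g) ((incl (P.card.map f) i).toFun j)).lt_iff_lt.mp ?_
  refine (lt_of_eq_of_lt (h k) (lt_of_lt_of_eq ?_ (h k').symm))
  exact incl_strictMono (P.card.map (g ≫ f)) i (incl_strictMono (P.cardFibMap g f i) j hk)

theorem assoc_iff (γ : Dm.card P.toCatOverS ⟶ P.φ ⋙ P.card)
    (pres : ∀ X, (Dm.lt P.toCatOverS).IsChosen X → P.lt.IsChosen (P.φ.obj X))
    (a : cofreeObj P.toCatOverS ⟶ P.toCatLtOverS) (ha : a = ⟨⟨P.φ, γ⟩, pres⟩)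
    (γ_fibMap : ∀ {X Y Z : P.C} (g : Z ⟶ Y) (f : Y ⟶ X) (i : Fin (P.card.obj X).size),
      γ.app (mk X i (g ≫ f)) ≫ P.card.map (P.fibMap g f i) =
        P.cardFibMap g f i ≫ γ.app (mk X i f)) :
    cofreeMap (counit.app P.toCatOverS) ≫ a = cofreeMap a.toHom ≫ a ↔
      (∀ {X Y Z : P.C} (g : Z ⟶ Y) (f : Y ⟶ X) (i : Fin (P.card.obj X).size)
        (j : Fin (fibre (P.card.map f) i).size),
        P.fibObj (P.fibMap g f i) ((γ.app (mk X i f)).toFun j) =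
          P.fibObj g ((incl (P.card.map f) i).toFun j)) ∧
      (∀ {X Y Z : P.C} (g : Z ⟶ Y) (f : Y ⟶ X) (i : Fin (P.card.obj X).size)
        (j : Fin (fibre (P.card.map f) i).size) (k : Fin (fibre (P.cardFibMap g f i) j).size),
        ((γ.app (mk _ ((γ.app (mk X i f)).toFun j) (P.fibMap g f i))).toFun
          ((fibreMap (P.cardFibMap g f i) (P.card.map (P.fibMap g f i))
            (γ.app (mk X i (g ≫ f))) j ((γ.app (mk X i f)).toFun j)
            fun x hx => (comm_apply (γ_fibMap g f i) x).trans
              (congrArg (γ.app (mk X i f)).toFun hx)).toFun k) : ℕ) =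
        (γ.app (mk Y ((incl (P.card.map f) i).toFun j) g)).toFun
          ((eqToHom (fibre_fibreMap _ _ _ (P.card.map_comp g f).symm i j)).toFun k)) ∧
      (∀ {X Y Z W : P.C} (h : W ⟶ Z) (g : Z ⟶ Y) (f : Y ⟶ X)
        (i : Fin (P.card.obj X).size) (j : Fin (fibre (P.card.map f) i).size),
        HEq (P.fibMap (P.fibMap h (g ≫ f) i) (P.fibMap g f i) ((γ.app (mk X i f)).toFun j))
          (P.fibMap h g ((incl (P.card.map f) i).toFun j))) := by
  subst ha
  -- the two sides on a canonical morphism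
  have hL : ∀ {X Y Z W : P.C} (h : W ⟶ Z) (g : Z ⟶ Y) (f : Y ⟶ X)
      (i : Fin (P.card.obj X).size) (j : Fin (fibre (P.card.map f) i).size),
      HEq (P.φ.map ((mapFunctor (counit.app P.toCatOverS)).map
        (mkMap (A := toOverS P.toCatOverS) (mk X i f) j (mkMap X i h (g ≫ f)) (mkMap X i g f))))
        (P.fibMap h g ((incl (P.card.map f) i).toFun j)) := fun _ _ _ _ _ => HEq.rfl
  have hR : ∀ {X Y Z W : P.C} (h : W ⟶ Z) (g : Z ⟶ Y) (f : Y ⟶ X)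
      (i : Fin (P.card.obj X).size) (j : Fin (fibre (P.card.map f) i).size),
      HEq (P.φ.map ((mapFunctor (A := toOverS P.toCatOverS) (B := P.toCatOverS) ⟨P.φ, γ⟩).map
        (mkMap (A := toOverS P.toCatOverS) (mk X i f) j (mkMap X i h (g ≫ f)) (mkMap X i g f))))
        (P.fibMap (P.fibMap h (g ≫ f) i) (P.fibMap g f i) ((γ.app (mk X i f)).toFun j)) := by
    intro X Y Z W h g f i j
    have e : (mapFunctor (A := toOverS P.toCatOverS) (B := P.toCatOverS) ⟨P.φ, γ⟩).obj
        (mk (A := toOverS P.toCatOverS) (mk X i f) j (mkMap X i h (g ≫ f) ≫ mkMap X i g f)) =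
        mk (P.fibObj f i) ((γ.app (mk X i f)).toFun j)
          (P.fibMap h (g ≫ f) i ≫ P.fibMap g f i) :=
      mk_congr rfl rfl rfl (heq_of_eq (P.φ.map_comp (mkMap X i h (g ≫ f)) (mkMap X i g f)))
    refine heq_map P.φ (g := mkMap (P.fibObj f i) ((γ.app (mk X i f)).toFun j)
      (P.fibMap h (g ≫ f) i) (P.fibMap g f i)) e rfl ?_
    exact heq_of_proj e rfl HEq.rfl
  have hν : ∀ {X Y Z : P.C} (g : Z ⟶ Y) (f : Y ⟶ X) (i : Fin (P.card.obj X).size)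
        (j : Fin (fibre (P.card.map f) i).size) (k : Fin (fibre (P.cardFibMap g f i) j).size),
      ((γ.app (mk Y ((incl (P.card.map f) i).toFun j) g)).toFun
        ((mapν (counit.app P.toCatOverS) (mk (A := toOverS P.toCatOverS) (mk X i f) j
          (mkMap X i g f))).toFun k) : ℕ) =
      (γ.app (mk Y ((incl (P.card.map f) i).toFun j) g)).toFun
          ((eqToHom (fibre_fibreMap _ _ _ (P.card.map_comp g f).symm i j)).toFun k) := by
    intro X Y Z g f i j k
    refine natTrans_val γ rfl ((mult_val g f i j k).trans ?_)
    exact (eqToHom_toFun_val _ k).symm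
  constructor
  · intro h
    refine ⟨fun {X Y Z} g f i j => ?_, fun {X Y Z} g f i j k => ?_,
      fun {X Y Z W} h' g f i j => ?_⟩
    · exact (congrArg (fun m : cofreeObj (toOverS P.toCatOverS) ⟶ P.toCatLtOverS => m.F.obj
        (mk (A := toOverS P.toCatOverS) (mk X i f) j (mkMap X i g f))) h).symm
    · refine Eq.trans ?_ (hν g f i j k)
      exact (congrArg (fun m : cofreeObj (toOverS P.toCatOverS) ⟶ P.toCatLtOverS =>
        ((m.ν.app (mk (A := toOverS P.toCatOverS) (mk X i f) j (mkMap X i g f))).toFun k : ℕ))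
          h).symm
    · refine (hR h' g f i j).symm.trans (HEq.trans ?_ (hL h' g f i j))
      exact (congr_arg_heq (fun m : cofreeObj (toOverS P.toCatOverS) ⟶ P.toCatLtOverS => m.F.map
        (mkMap (A := toOverS P.toCatOverS) (mk X i f) j (mkMap X i h' (g ≫ f)) (mkMap X i g f)))
          h).symm
  · rintro ⟨h1, h2, h3⟩
    have obj_cases : ∀ {motive : Obj (toOverS P.toCatOverS) → Prop}
        (_ : ∀ {X Y Z : P.C} (g : Z ⟶ Y) (f : Y ⟶ X) (i : Fin (P.card.obj X).size)
          (j : Fin (fibre (P.card.map f) i).size),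
          motive (mk (A := toOverS P.toCatOverS) (mk X i f) j (mkMap X i g f))) (a), motive a := by
      rintro motive h ⟨⟨⟨⟨X, i⟩, ⟨Y, ⟨⟨⟩⟩, f⟩⟩, j⟩, ⟨V, ⟨⟨⟩⟩, g⟩⟩
      exact hom_cases (motive := fun V g => motive
        (mk (A := toOverS P.toCatOverS) (mk X i f) j g)) (fun Z g => h g f i j) V g
    refine CatLtOverS.hom_ext ?_ ?_ ?_
    · exact fun a => obj_cases (motive := fun a => P.φ.obj
        ((mapFunctor (counit.app P.toCatOverS)).obj a) = P.φ.obj ((mapFunctor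
          (A := toOverS P.toCatOverS) (B := P.toCatOverS) ⟨P.φ, γ⟩).obj a))
        (fun g f i j => (h1 g f i j).symm) a
    · intro a b
      refine obj_cases (motive := fun b => ∀ k : a ⟶ b, HEq (P.φ.map
        ((mapFunctor (counit.app P.toCatOverS)).map k)) (P.φ.map ((mapFunctor
          (A := toOverS P.toCatOverS) (B := P.toCatOverS) ⟨P.φ, γ⟩).map k))) ?_ b
      intro X Y Z g f i j k
      refine hom_cases (A := toOverS P.toCatOverS) (motive := fun a k => HEq (P.φ.map
        ((mapFunctor (counit.app P.toCatOverS)).map k)) (P.φ.map ((mapFunctor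
          (A := toOverS P.toCatOverS) (B := P.toCatOverS) ⟨P.φ, γ⟩).map k))) ?_ a k
      intro V k
      refine hom_cases (motive := fun V k => HEq (P.φ.map
        ((mapFunctor (counit.app P.toCatOverS)).map (mkMap (A := toOverS P.toCatOverS)
          (mk X i f) j k (mkMap X i g f)))) (P.φ.map ((mapFunctor
          (A := toOverS P.toCatOverS) (B := P.toCatOverS) ⟨P.φ, γ⟩).map
          (mkMap (A := toOverS P.toCatOverS) (mk X i f) j k (mkMap X i g f))))) ?_ V k
      intro W h
      exact (hL h g f i j).trans ((h3 h g f i j).symm.trans (hR h g f i j).symm)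
    · exact fun a => obj_cases (motive := fun a => ∀ x : Fin ((Dm.card (toOverS P.toCatOverS)).obj
        a).size, ((γ.app ((mapFunctor (counit.app P.toCatOverS)).obj a)).toFun
          ((mapν (counit.app P.toCatOverS) a).toFun x) : ℕ) =
        ((γ.app ((mapFunctor (A := toOverS P.toCatOverS) (B := P.toCatOverS) ⟨P.φ, γ⟩).obj
          a)).toFun ((mapν (A := toOverS P.toCatOverS) (B := P.toCatOverS) ⟨P.φ, γ⟩ a).toFun x)))
        (fun g f i j k => (hν g f i j k).trans (h2 g f i j k).symm) a

theorem hom_iff (m : P.toCatLtOverS ⟶ Q.toCatLtOverS) :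
    cofreeMap m.toHom ≫ b = a ≫ m ↔
      (∀ {X Y : P.C} (f : Y ⟶ X) (i : Fin (P.card.obj X).size),
        m.F.obj (a.F.obj (mk X i f)) = b.F.obj (mk _ ((m.ν.app X).toFun i) (m.F.map f))) ∧
      (∀ {X Y Z : P.C} (g : Z ⟶ Y) (f : Y ⟶ X) (i : Fin (P.card.obj X).size),
        HEq (m.F.map (a.F.map (mkMap X i g f)))
          (b.F.map (mkMap _ ((m.ν.app X).toFun i) (m.F.map g) (m.F.map f)))) ∧
      (∀ {X Y : P.C} (f : Y ⟶ X) (i : Fin (P.card.obj X).size)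
        (x : Fin (fibre (P.card.map f) i).size),
        ((m.ν.app (a.F.obj (mk X i f))).toFun ((a.ν.app (mk X i f)).toFun x) : ℕ) =
          (b.ν.app (mk _ ((m.ν.app X).toFun i) (m.F.map f))).toFun
            ((mapν m.toHom (mk X i f)).toFun x)) := by
  have hmap : ∀ {X Y Z : P.C} (g : Z ⟶ Y) (f : Y ⟶ X) (i : Fin (P.card.obj X).size),
      HEq (b.F.map ((mapFunctor m.toHom).map (mkMap X i g f)))
        (b.F.map (mkMap _ ((m.ν.app X).toFun i) (m.F.map g) (m.F.map f))) := by
    intro X Y Z g f i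
    have e : (mapFunctor m.toHom).obj (mk X i (g ≫ f)) =
        mk _ ((m.ν.app X).toFun i) (m.F.map g ≫ m.F.map f) :=
      mk_congr rfl rfl rfl (heq_of_eq (m.F.map_comp g f))
    exact heq_map b.F e rfl (heq_of_proj e rfl HEq.rfl)
  constructor
  · intro h
    refine ⟨fun f i => ?_, fun g f i => ?_, fun f i x => ?_⟩
    · exact (congrArg (fun m : cofreeObj P.toCatOverS ⟶ Q.toCatLtOverS =>
        m.F.obj (mk _ i f)) h).symm
    · exact (congr_arg_heq (fun m : cofreeObj P.toCatOverS ⟶ Q.toCatLtOverS =>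
        m.F.map (mkMap _ i g f)) h).symm.trans (hmap g f i)
    · exact (congrArg (fun m : cofreeObj P.toCatOverS ⟶ Q.toCatLtOverS =>
        ((m.ν.app (mk _ i f)).toFun x : ℕ)) h).symm
  · rintro ⟨h1, h2, h3⟩
    refine CatLtOverS.hom_ext ?_ ?_ ?_
    · rintro ⟨⟨X, i⟩, ⟨Y, ⟨⟨⟩⟩, f⟩⟩
      exact (h1 f i).symm
    · rintro V ⟨⟨X, i⟩, ⟨Y, ⟨⟨⟩⟩, f⟩⟩ k
      refine hom_cases (motive := fun V k => HEq (b.F.map ((mapFunctor m.toHom).map k))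
        (m.F.map (a.F.map k))) ?_ V k
      intro Z g
      exact (hmap g f i).trans (h2 g f i).symm
    · rintro ⟨⟨X, i⟩, ⟨Y, ⟨⟨⟩⟩, f⟩⟩ x
      exact (h3 f i x).symm

end structureMaps

/-- The structure map `(φ, γ)` of the algebra associated to a lax-operadic category. -/
def LaxOpCat.str (L : LaxOpCat.{u}) : Dm.cofreeObj L.toCatOverS ⟶ L.toCatLtOverS where
  F := L.φ
  ν :=
    { app := fun a => L.γ a.2.hom a.1.2
      naturality := by
        rintro V ⟨⟨X, i⟩, ⟨Y, ⟨⟨⟩⟩, f⟩⟩ k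
        refine Dm.hom_cases (motive := fun V k => (Dm.card L.toCatOverS).map k ≫ L.γ f i =
          L.γ V.2.hom V.1.2 ≫ L.card.map (L.φ.map k)) ?_ V k
        intro Z g
        exact (L.γ_fibMap g f i).symm }
  pres a h := by
    obtain ⟨X, i, rfl⟩ := Dm.isChosen_iff.mp h
    exact L.fibObj_id X i

/-- The algebra associated to a lax-operadic category: its structure map is given by the fibres
and the relabelling functions. -/
def LaxOpCat.toAlgebra (L : LaxOpCat.{u}) : modifiedDecalageMonad.{u}.Algebra where
  A := L.toCatLtOverS
  a := L.str
  unit := (unit_iff L.str rfl).mpr ⟨L.fibObj_τ, L.fibMap_τ, L.γ_τ⟩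
  assoc := (assoc_iff L.str.ν L.str.pres L.str rfl L.γ_fibMap).mpr
    ⟨L.fibObj_fibMap, L.γ_γ, L.fibMap_fibMap⟩

/-- The lax-operadic category associated to an algebra: the fibres are given by the functor
part of the structure map, and the relabelling functions by its natural transformation part. -/
def algebraToLax (A : modifiedDecalageMonad.{u}.Algebra) : LaxOpCat.{u} :=
  let a : Dm.cofreeObj A.A.toCatOverS ⟶ A.A := A.a
  let P : FibreData.{u} :=
    { toCatLtOverS := A.A
      fib := fun X i => Sigma.incl
        (C := fun p : (Σ X : A.A.C, Fin (A.A.card.obj X).size) => Over p.1) ⟨X, i⟩ ⋙ a.F }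
  have hF : a.F = P.φ := Functor.hext (fun _ => rfl) (by rintro ⟨p, a⟩ ⟨_, b⟩ ⟨f⟩; rfl)
  have hn : ∀ {X Y Z : P.C} (g : Z ⟶ Y) (f : Y ⟶ X) (i : Fin (P.card.obj X).size),
      a.ν.app (Dm.mk X i (g ≫ f)) ≫ P.card.map (P.fibMap g f i) =
        P.cardFibMap g f i ≫ a.ν.app (Dm.mk X i f) :=
    fun g f i => (a.ν.naturality (Dm.mkMap _ i g f)).symm
  have hu := (unit_iff a hF).mp A.unit
  let γ' : Dm.card P.toCatOverS ⟶ P.φ ⋙ P.card :=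
    { app := a.ν.app
      naturality := by
        rintro ⟨p, V⟩ ⟨_, W⟩ ⟨k⟩
        exact a.ν.naturality (Sigma.SigmaHom.mk k) }
  have ha' : a = ⟨⟨P.φ, γ'⟩, a.pres⟩ := CatLtOverS.hom_ext (fun _ => rfl)
    (by rintro ⟨p, V⟩ ⟨_, W⟩ ⟨k⟩; rfl) (fun _ _ => rfl)
  have ha := (assoc_iff (P := P) γ' a.pres a ha' hn).mp A.assoc
  { toFibreData := P
    γ := fun f i => a.ν.app (Dm.mk _ i f)
    fibObj_id := fun X i => a.pres _ (Dm.isChosen_mk_id X i)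
    γ_fibMap := hn
    fibObj_τ := hu.1
    fibMap_τ := hu.2.1
    γ_τ := hu.2.2
    fibObj_fibMap := ha.1
    γ_γ := ha.2.1
    fibMap_fibMap := ha.2.2 }

namespace LaxOpCat

theorem Hom.ext' {L M : LaxOpCat.{u}} {f g : Hom L M} (h : f.toLtHom = g.toLtHom) : f = g := by
  cases f; cases g; congr

/-- The algebra map given by a lax-operadic functor. -/
def Hom.toAlgebraHom {L M : LaxOpCat.{u}} (f : Hom L M) : L.toAlgebra ⟶ M.toAlgebra where
  f := f.toLtHom
  h := (hom_iff L.str M.str f.toLtHom).mpr ⟨f.map_fibObj, f.map_fibMap, f.map_γ⟩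

/-- The lax-operadic functor given by an algebra map. -/
def homOfAlgebraHom {L M : LaxOpCat.{u}} (f : L.toAlgebra ⟶ M.toAlgebra) : Hom L M :=
  have h := (hom_iff L.str M.str f.f).mp f.h
  { toLtHom := f.f
    map_fibObj := h.1
    map_fibMap := h.2.1
    map_γ := h.2.2 }

instance : Category LaxOpCat.{u} where
  Hom := Hom
  id L :=
    { toLtHom := 𝟙 L.toCatLtOverS
      map_fibObj := (homOfAlgebraHom (𝟙 L.toAlgebra)).map_fibObj
      map_fibMap := (homOfAlgebraHom (𝟙 L.toAlgebra)).map_fibMap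
      map_γ := (homOfAlgebraHom (𝟙 L.toAlgebra)).map_γ }
  comp f g :=
    { toLtHom := CategoryStruct.comp (obj := CatLtOverS) f.toLtHom g.toLtHom
      map_fibObj := (homOfAlgebraHom (f.toAlgebraHom ≫ g.toAlgebraHom)).map_fibObj
      map_fibMap := (homOfAlgebraHom (f.toAlgebraHom ≫ g.toAlgebraHom)).map_fibMap
      map_γ := (homOfAlgebraHom (f.toAlgebraHom ≫ g.toAlgebraHom)).map_γ }
  id_comp f := Hom.ext' (Category.id_comp (obj := CatLtOverS) f.toLtHom)
  comp_id f := Hom.ext' (Category.comp_id (obj := CatLtOverS) f.toLtHom)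
  assoc f g h := Hom.ext' (Category.assoc (obj := CatLtOverS) f.toLtHom g.toLtHom
    h.toLtHom)

end LaxOpCat

/-- The functor from algebras to lax-operadic categories. -/
def algebraToLaxFunctor : modifiedDecalageMonad.{u}.Algebra ⥤ LaxOpCat.{u} where
  obj := algebraToLax
  map {A B} f :=
    have h := (hom_iff (P := (algebraToLax A).toFibreData) (Q := (algebraToLax B).toFibreData)
      A.a B.a f.f).mp f.h
    show LaxOpCat.Hom (algebraToLax A) (algebraToLax B) from
    { toLtHom := f.f
      map_fibObj := h.1
      map_fibMap := h.2.1
      map_γ := h.2.2 }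

/-- The functor from lax-operadic categories to algebras. -/
def laxToAlgebraFunctor : LaxOpCat.{u} ⥤ modifiedDecalageMonad.{u}.Algebra where
  obj := LaxOpCat.toAlgebra
  map f := LaxOpCat.Hom.toAlgebraHom f

theorem algebra_ext {A B : modifiedDecalageMonad.{u}.Algebra} (h : A.A = B.A)
    (ha : HEq A.a B.a) : A = B := by
  cases A; cases B
  dsimp only at h
  subst h
  cases ha
  rfl

theorem algebra_hom_heq {A B A' B' : modifiedDecalageMonad.{u}.Algebra} (hA : A = A') (hB : B = B')
    {f : A ⟶ B} {g : A' ⟶ B'} (h : HEq f.f g.f) : HEq f g := by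
  subst hA hB
  exact heq_of_eq (Monad.Algebra.Hom.ext (eq_of_heq h))

theorem toAlgebra_algebraToLax (A : modifiedDecalageMonad.{u}.Algebra) :
    (algebraToLax A).toAlgebra = A :=
  algebra_ext rfl (heq_of_eq (CatLtOverS.hom_ext (fun _ => rfl)
    (by rintro ⟨p, V⟩ ⟨_, W⟩ ⟨k⟩; rfl) (fun _ _ => rfl)))

/-- The isomorphism between the category of algebras for the modified décalage monad on
`Cat_ℓt // 𝒮` and the category of lax-operadic categories. -/
def algebraIso : Cat.of modifiedDecalageMonad.{u}.Algebra ≅ Cat.of LaxOpCat.{u} where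
  hom := algebraToLaxFunctor.toCatHom
  inv := laxToAlgebraFunctor.toCatHom
  hom_inv_id := Cat.ext (Functor.hext toAlgebra_algebraToLax fun A B _ =>
    algebra_hom_heq (toAlgebra_algebraToLax A) (toAlgebra_algebraToLax B) HEq.rfl)
  inv_hom_id := Cat.ext (Functor.hext (fun _ => rfl) fun _ _ _ => HEq.rfl)

/-! ### Operadic categories among lax-operadic categories -/

namespace FinS

theorem eqToHom_app_val {C : Type u} [SmallCategory C] {F G : C ⥤ FinS} (h : F = G) (X : C)
    (x : Fin (F.obj X).size) : (((eqToHom h).app X).toFun x : ℕ) = x := by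
  subst h; rfl

theorem fibre_congr {m n m' n' : FinS} {φ : m ⟶ n} {φ' : m' ⟶ n'} {i : Fin n.size}
    {i' : Fin n'.size} (hm : m = m') (hn : n = n') (hφ : HEq φ φ') (hi : (i : ℕ) = i') :
    fibre φ i = fibre φ' i' := by
  subst hm hn
  obtain rfl := eq_of_heq hφ
  rw [Fin.ext hi]

theorem comp_eqToHom_of_heq {m n m' n' : FinS} {φ : m ⟶ n} {φ' : m' ⟶ n'} (hm : m = m')
    (hn : n = n') (hφ : HEq φ φ') : eqToHom hm.symm ≫ φ = φ' ≫ eqToHom hn.symm := by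
  subst hm hn
  obtain rfl := eq_of_heq hφ
  rfl

/-- A map of fibres induced by an identity is an identity. -/
theorem fibreMap_val {m n m' n' : FinS} {φ : m ⟶ n} {φ' : m' ⟶ n'} {a : m ⟶ m'} {i : Fin n.size}
    {i' : Fin n'.size} (h : ∀ x, φ.toFun x = i → φ'.toFun (a.toFun x) = i')
    (e : fibre φ i = fibre φ' i') (ha : ∀ x, (a.toFun x : ℕ) = x) (x : Fin (fibre φ i).size) :
    ((fibreMap φ φ' a i i' h).toFun x : ℕ) = x := by
  refine Dm.val_of_strictMono (congrArg FinS.size e) _ (fun k l hkl => ?_) x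
  refine (Dm.incl_strictMono φ' i').lt_iff_lt.mp ?_
  rw [incl_fibreMap, incl_fibreMap]
  refine Fin.lt_def.mpr ?_
  rw [ha, ha]
  exact Dm.incl_strictMono φ i hkl

end FinS

namespace OpCat

/-- An operadic category is a lax-operadic category whose relabelling functions are the identities
`|f|⁻¹(i) = |f⁻¹(i)|`. -/
def toLax (O : OpCat.{u}) : LaxOpCat.{u} where
  toFibreData := O.toFibreData
  γ f i := eqToHom (O.card_fibObj f i).symm
  fibObj_id := O.fibObj_id
  γ_fibMap g f i := comp_eqToHom_of_heq (O.card_fibObj _ i) (O.card_fibObj f i)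
    (O.card_fibMap g f i)
  fibObj_τ := O.fibObj_τ
  fibMap_τ := O.fibMap_τ
  γ_τ X i x := eqToHom_toFun_val _ x
  fibObj_fibMap := O.fibObj_fibMap
  γ_γ g f i j k := by
    refine (eqToHom_toFun_val _ _).trans (Eq.trans ?_ (eqToHom_toFun_val _ _).symm)
    refine Eq.trans ?_ (eqToHom_toFun_val _ k).symm
    refine fibreMap_val _ ?_ (eqToHom_toFun_val _) k
    exact fibre_congr (O.card_fibObj _ _).symm (O.card_fibObj _ _).symm (O.card_fibMap g f i).symm
      (eqToHom_toFun_val _ j).symm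
  fibMap_fibMap := O.fibMap_fibMap

theorem Hom.ext' {O P : OpCat.{u}} {f g : Hom O P} (h : f.F = g.F) : f = g := by
  cases f; cases g; congr

theorem heq_fibMap {P : FibreData.{u}} {X Y Z : P.C} (g : Z ⟶ Y) (f : Y ⟶ X)
    {i i' : Fin (P.card.obj X).size} (h : i = i') : HEq (P.fibMap g f i) (P.fibMap g f i') := by
  subst h; rfl

instance : Category OpCat.{u} where
  Hom := Hom
  id O :=
    { F := 𝟭 O.C
      pres := fun _ h => h
      card_comp := rfl
      map_fibObj := fun _ _ => rfl
      map_fibMap := fun _ _ _ => HEq.rfl }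
  comp {O P Q} F G :=
    have hi : ∀ (X : O.C) (i : Fin (O.card.obj X).size),
        (eqToHom (Functor.congr_obj G.card_comp (F.F.obj X))).toFun
          ((eqToHom (Functor.congr_obj F.card_comp X)).toFun i) =
        (eqToHom (Functor.congr_obj (F.card_comp.trans
          (congrArg (F.F ⋙ ·) G.card_comp)) X)).toFun i := fun X i =>
      Fin.ext ((eqToHom_toFun_val _ _).trans
        ((eqToHom_toFun_val _ _).trans (eqToHom_toFun_val _ _).symm))
    { F := F.F ⋙ G.F
      pres := fun X h => G.pres _ (F.pres X h)
      card_comp := F.card_comp.trans (congrArg (F.F ⋙ ·) G.card_comp)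
      map_fibObj := fun f i => (congrArg G.F.obj (F.map_fibObj f i)).trans
        ((G.map_fibObj _ _).trans (congrArg (Q.fibObj _) (hi _ i)))
      map_fibMap := fun g f i =>
        (Dm.heq_map G.F ((F.map_fibObj _ i).trans (by rw [F.F.map_comp])) (F.map_fibObj f i)
          (F.map_fibMap g f i)).trans
        ((G.map_fibMap _ _ _).trans (heq_fibMap _ _ (hi _ i))) }
  id_comp _ := rfl
  comp_id _ := rfl
  assoc _ _ _ := rfl

/-- An operadic functor is a lax-operadic functor for which the functions
`ν_X : |X| ⟶ |FX|` are identities. -/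
def Hom.toLax {O P : OpCat.{u}} (F : Hom O P) : LaxOpCat.Hom O.toLax P.toLax where
  F := F.F
  ν := eqToHom F.card_comp
  pres := F.pres
  map_fibObj f i := (F.map_fibObj f i).trans (congrArg (P.fibObj _)
    (Fin.ext ((eqToHom_toFun_val _ i).trans (eqToHom_app_val F.card_comp _ i).symm)))
  map_fibMap g f i := (F.map_fibMap g f i).trans (heq_fibMap _ _
    (Fin.ext ((eqToHom_toFun_val _ i).trans (eqToHom_app_val F.card_comp _ i).symm)))
  map_γ {X Y} f i x := by
    refine (eqToHom_app_val F.card_comp _ _).trans ((eqToHom_toFun_val (O.card_fibObj f i).symm x).trans ?_)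
    refine Eq.trans ?_ (eqToHom_toFun_val (P.card_fibObj _ _).symm _).symm
    refine (fibreMap_val _ ?_ (eqToHom_app_val F.card_comp _) x).symm
    exact fibre_congr (Functor.congr_obj F.card_comp Y) (Functor.congr_obj F.card_comp X)
      (congr_arg_heq (fun K : O.C ⥤ FinS => K.map f) F.card_comp)
      (eqToHom_app_val F.card_comp X i).symm

/-- The inclusion of the category of operadic categories and operadic functors in the
category of lax-operadic categories and lax-operadic functors. -/
def inclusion : OpCat.{u} ⥤ LaxOpCat.{u} where
  obj := toLax
  map F := Hom.toLax F
  map_id _ := LaxOpCat.Hom.ext' (CatLtOverS.hom_ext (fun _ => rfl) (fun _ _ _ => HEq.rfl)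
    fun _ _ => rfl)
  map_comp F G := LaxOpCat.Hom.ext' (CatLtOverS.hom_ext (fun _ => rfl) (fun _ _ _ => HEq.rfl)
    fun X x => (eqToHom_app_val (Hom.card_comp (F ≫ G)) X x).trans (((eqToHom_app_val
      G.card_comp (F.F.obj X) _).trans
      (eqToHom_app_val F.card_comp X x)).symm))

end OpCat

end Decalage

end

namespace Decalage

open FinS

/-! The value of the structure map of an algebra at the object `(X, i, f)` of `D_m(C)` consists of
the fibre `f⁻¹(i)` together with the function `γ_{f,i} : |f|⁻¹(i) ⟶ |f⁻¹(i)|`. As every object of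
`D_m(C)` is such a triple, strictness of the structure map says exactly that `|f⁻¹(i)| = |f|⁻¹(i)`
and that every `γ_{f,i}` is an identity. The operadic axioms are what the lax-operadic ones become
in that case: naturality of `γ` turns into `|g^f_i| = |g|^{|f|}_i`, the index `γ j` turns into `j`
in the two iterated fibre axioms, and the two axioms equating values of relabelling functions hold
automatically, as `OpCat.toLax` shows. For morphisms the same happens with `ν` in place of `γ`:
identity components turn the index `ν_X i` into `i`, and the compatibility of `ν` with the
relabelling functions becomes automatic.

What remains is to control equality of objects of `𝒮` and of functors into it.
`CatLtOverS.isStrict_iff` replaces the equality of cardinality functors contained in strictness by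
equality on objects and a condition on the underlying numbers of elements.
`LaxOpCat.exists_eq_toLax_iff` and `OpCat.exists_eq_toLax_iff` are the two halves of the result,
stated for lax-operadic categories; they are carried over to algebras along the isomorphism
`algebraIso`. -/

/-! ### Pointwise criterion for strictness -/

/-- A map `(F, ν)` of `Cat_ℓt // 𝒮` is strict if and only if `|X| = |FX|` for all `X`, and each
`ν_X` is the identity function. -/
theorem CatLtOverS.isStrict_iff {A B : CatLtOverS.{u}} (f : A ⟶ B) :
    CatLtOverS.IsStrict f ↔ (∀ X, A.card.obj X = B.card.obj (f.F.obj X)) ∧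
      ∀ (X : A.C) (x : Fin (A.card.obj X).size), ((f.ν.app X).toFun x : ℕ) = x := by
  constructor
  · rintro ⟨h, hν⟩
    exact ⟨Functor.congr_obj h, fun X x => by rw [hν]; exact eqToHom_app_val h X x⟩
  · rintro ⟨hobj, hν⟩
    -- A function between equal objects of `𝒮` that fixes underlying numbers is the transport along
    -- that equality, so the components of `ν` are invertible.
    have happ : ∀ X, f.ν.app X = eqToHom (hobj X) := fun X => FinS.hom_ext fun x =>
      Fin.ext ((hν X x).trans (eqToHom_toFun_val (hobj X) x).symm)
    have h : A.card = f.F ⋙ B.card := by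
      -- Only agreement on objects has been assumed. Agreement on maps is forced by naturality:
      -- since the components of `ν` are transports, the naturality square at `g` says that `|g|`
      -- and `|Fg|` are conjugate along the equalities of objects, as `Functor.ext` requires.
      refine CategoryTheory.Functor.ext hobj fun X Y g => ?_
      have hn := f.ν.naturality g
      rw [happ, happ] at hn
      rw [← Category.assoc, ← hn, Category.assoc, eqToHom_trans, eqToHom_refl, Category.comp_id]
    refine ⟨h, ?_⟩
    ext X : 2
    exact FinS.hom_ext fun x => Fin.ext ((hν X x).trans (eqToHom_app_val h X x).symm)

/-! ### Operadic categories as lax-operadic categories with strict structure map -/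

/-- Converse of `comp_eqToHom_of_heq`. It turns the naturality square of a `γ` made of transports
into the operadic axiom on cardinalities of fibre maps, which is stated with `HEq`. -/
theorem FinS.heq_of_comp_eqToHom {m n m' n' : FinS} {φ : m ⟶ n} {φ' : m' ⟶ n'} (hm : m = m')
    (hn : n = n') (h : eqToHom hm.symm ≫ φ = φ' ≫ eqToHom hn.symm) : HEq φ φ' := by
  subst hm hn
  simpa using h

namespace LaxOpCat

/-- Over the fibre data, the relabelling functions are the only further data; the other fields are
propositions, so proof irrelevance settles them. The hypothesis on `γ` must be heterogeneous because
its type depends on the fibre data. -/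
theorem ext' {L M : LaxOpCat.{u}} (h : L.toFibreData = M.toFibreData)
    (hγ : HEq (@LaxOpCat.γ L) (@LaxOpCat.γ M)) : L = M := by
  cases L; cases M
  dsimp only at h
  subst h
  cases hγ
  rfl

variable (L : LaxOpCat.{u})

/-- A lax-operadic category whose relabelling functions are equal to the identities
`|f|⁻¹(i) = |f⁻¹(i)|` is an operadic category. -/
def toOpCat (hobj : ∀ {X Y : L.C} (f : Y ⟶ X) (i : Fin (L.card.obj X).size),
      L.card.obj (L.fibObj f i) = fibre (L.card.map f) i)
    (hγ : ∀ {X Y : L.C} (f : Y ⟶ X) (i : Fin (L.card.obj X).size),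
      L.γ f i = eqToHom (hobj f i).symm) : OpCat.{u} where
  toFibreData := L.toFibreData
  fibObj_id := L.fibObj_id
  card_fibObj := hobj
  -- Reading the transports backwards as `γ` makes the required square literally the naturality of
  -- `γ`. The same rewriting serves the two iterated fibre axioms below, whose indices are
  -- transported elements of `|f|⁻¹(i)`.
  card_fibMap g f i := heq_of_comp_eqToHom (hobj _ i) (hobj f i) (by
    rw [← hγ, ← hγ]
    exact L.γ_fibMap g f i)
  fibObj_τ := L.fibObj_τ
  fibMap_τ := L.fibMap_τ
  fibObj_fibMap g f i j := by
    rw [← hγ]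
    exact L.fibObj_fibMap g f i j
  fibMap_fibMap h g f i j := by
    rw [← hγ]
    exact L.fibMap_fibMap h g f i j

/-- A lax-operadic category is operadic if and only if the structure map of the associated algebra
is strict. -/
theorem exists_eq_toLax_iff :
    (∃ O : OpCat.{u}, L = O.toLax) ↔ CatLtOverS.IsStrict L.str := by
  constructor
  · rintro ⟨O, rfl⟩
    -- The components of the structure map of `O.toLax` are transports by construction. The
    -- pointwise criterion spares a direct proof that the two cardinality functors on `D_m(C)` are
    -- equal.
    exact (CatLtOverS.isStrict_iff _).mpr ⟨fun a => (O.card_fibObj a.2.hom a.1.2).symm,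
      fun a x => eqToHom_toFun_val (O.card_fibObj a.2.hom a.1.2).symm x⟩
  · intro h
    obtain ⟨hobj, hν⟩ := (CatLtOverS.isStrict_iff _).mp h
    -- Evaluating strictness at the object `(X, i, f)` of `D_m(C)`: its cardinality is `|f|⁻¹(i)`,
    -- and the structure map sends it to `f⁻¹(i)` with component `γ_{f,i}`.
    have hobj' : ∀ {X Y : L.C} (f : Y ⟶ X) (i : Fin (L.card.obj X).size),
        L.card.obj (L.fibObj f i) = fibre (L.card.map f) i :=
      fun f i => (hobj (Dm.mk _ i f)).symm
    have hγ : ∀ {X Y : L.C} (f : Y ⟶ X) (i : Fin (L.card.obj X).size),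
        L.γ f i = eqToHom (hobj' f i).symm := fun f i => FinS.hom_ext fun x =>
      Fin.ext ((hν (Dm.mk _ i f) x).trans (eqToHom_toFun_val (hobj' f i).symm x).symm)
    -- Passing to the operadic category and back leaves the fibre data untouched and replaces `γ` by
    -- transports, so only the relabelling functions need comparing.
    refine ⟨L.toOpCat hobj' hγ, ext' rfl (heq_of_eq ?_)⟩
    funext X Y f i
    exact hγ f i

end LaxOpCat

/-! ### Operadic functors as strict lax-operadic functors -/

/-- A lax-operadic functor between operadic categories is operadic if and only if its underlying
map of `Cat_ℓt // 𝒮` is strict. -/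
theorem OpCat.exists_eq_toLax_iff {O P : OpCat.{u}} (f : LaxOpCat.Hom O.toLax P.toLax) :
    (∃ F : OpCat.Hom O P, f = F.toLax) ↔
      CatLtOverS.IsStrict (A := O.toCatLtOverS) (B := P.toCatLtOverS) f.toLtHom := by
  constructor
  · rintro ⟨F, rfl⟩
    -- The transformation attached to an operadic functor is defined as the transport along
    -- `F.card_comp`, which is strictness verbatim.
    exact ⟨F.card_comp, rfl⟩
  · rintro ⟨h, hν⟩
    -- The lax axioms index fibres by `ν_X i`, the operadic ones by `i` transported along `|X| =
    -- |FX|`. Strictness gives both elements the same underlying number.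
    have hi : ∀ (X : O.C) (i : Fin (O.card.obj X).size),
        (f.ν.app X).toFun i = (eqToHom (Functor.congr_obj h X)).toFun i := fun X i =>
      Fin.ext ((congrArg (fun ν : O.card ⟶ f.F ⋙ P.card => ((ν.app X).toFun i : ℕ)) hν).trans
        ((eqToHom_app_val h X i).trans (eqToHom_toFun_val (Functor.congr_obj h X) i).symm))
    refine ⟨⟨f.F, f.pres, h, fun f' i => ?_, fun g f' i => ?_⟩, ?_⟩
    · exact (f.map_fibObj f' i).trans (congrArg (P.fibObj _) (hi _ i))
    · exact (f.map_fibMap g f' i).trans (heq_fibMap _ _ (hi _ i))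
    -- The underlying functors coincide by definition, and a lax-operadic functor is determined by
    -- its underlying map, so only the two transformations need comparing; `hν` identifies them.
    · refine LaxOpCat.Hom.ext' (CatLtOverS.hom_ext (fun _ => rfl) (fun _ _ _ => HEq.rfl) ?_)
      exact fun X x => congrArg (fun ν : O.card ⟶ f.F ⋙ P.card => ((ν.app X).toFun x : ℕ)) hν

end Decalage

/-! ### Transfer to algebras for the modified décalage monad -/

/-- An algebra corresponds to an operadic category by an equality of objects in the category of
lax-operadic categories, so comparing morphisms in the second half requires conjugation by the
transports along `hA` and `hB`. -/
theorem proposition5 :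
    (∀ A : Decalage.modifiedDecalageMonad.{u}.Algebra,
      (∃ O : Decalage.OpCat.{u},
        Decalage.algebraIso.{u}.hom.toFunctor.obj A = Decalage.OpCat.inclusion.{u}.obj O) ↔
      Decalage.CatLtOverS.IsStrict A.a) ∧
    (∀ (A B : Decalage.modifiedDecalageMonad.{u}.Algebra) (f : A ⟶ B) (O P : Decalage.OpCat.{u})
      (hA : Decalage.algebraIso.{u}.hom.toFunctor.obj A = Decalage.OpCat.inclusion.{u}.obj O)
      (hB : Decalage.algebraIso.{u}.hom.toFunctor.obj B = Decalage.OpCat.inclusion.{u}.obj P),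
      (∃ F : O ⟶ P, Decalage.algebraIso.{u}.hom.toFunctor.map f =
        eqToHom hA ≫ Decalage.OpCat.inclusion.{u}.map F ≫ eqToHom hB.symm) ↔
      Decalage.CatLtOverS.IsStrict f.f) := by
  constructor
  · intro A
    -- Every algebra comes from a lax-operadic category. For one of this form the isomorphism
    -- returns `L` and the structure map is `L.str`, both by definition, so the statement about `L`
    -- applies unchanged.
    obtain ⟨L, rfl⟩ : ∃ L : Decalage.LaxOpCat.{u}, A = L.toAlgebra :=
      ⟨_, (Decalage.toAlgebra_algebraToLax A).symm⟩
    exact L.exists_eq_toLax_iff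
  · intro A B f O P hA hB
    -- Applying the inverse of the isomorphism to `hA` allows `A` to be replaced by the algebra of
    -- `O`. Both sides of `hA` then agree by definition.
    obtain rfl : A = O.toLax.toAlgebra := (Decalage.toAlgebra_algebraToLax A).symm.trans
      (congrArg Decalage.LaxOpCat.toAlgebra hA)
    obtain rfl : B = P.toLax.toAlgebra := (Decalage.toAlgebra_algebraToLax B).symm.trans
      (congrArg Decalage.LaxOpCat.toAlgebra hB)
    refine Iff.trans (exists_congr fun F => ?_)
      (Decalage.OpCat.exists_eq_toLax_iff (Decalage.LaxOpCat.homOfAlgebraHom f))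
    -- After the substitutions the two transports are identities by definition, so the unit laws
    -- remove them.
    have h : eqToHom hA ≫ Decalage.OpCat.inclusion.{u}.map F ≫ eqToHom hB.symm =
        Decalage.OpCat.inclusion.{u}.map F :=
      (Category.id_comp _).trans (Category.comp_id _)
    -- The image of `f` under the isomorphism is by definition `homOfAlgebraHom f`, so the two
    -- equations differ only in their right-hand sides.
    exact Eq.congr_right h
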